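/- Let $\lambda\in\mathbb{R}\setminus\{0\}$ and let $u_0:\mathbb{R}\to\mathbb{R}$ be smooth and periodic with period $1$ (so that $u_0'$ has mean zero). Put $M_0=\max_{[0,1]}u_0'$ and $m_0=\min_{[0,1]}u_0'$. Denote by $\overline\alpha_i$ the points of $[0,1]$ at which $u_0'=M_0$ and by $\underline\alpha_j$ the points of $[0,1]$ at which $u_0'=m_0$. If $\lambda>0$, assume that there are only finitely many $\overline\alpha_i$; if $\lambda>1$, assume moreover that $u_0'''(\overline\alpha_i)\neq0$ for all $i$. If $\lambda<0$, assume that there are only finitely many $\underline\alpha_j$. Let $\eta_*=\frac1{\lambda M_0}$ if $\lambda>0$, $\eta_*=\frac1{\lambda m_0}$ if $\lambda<0$, and $$t_*=\lim_{\eta\uparrow\eta_*}\int_0^{\eta}\left(\int_0^1\frac{d\alpha}{(1-\lambda\mu u_0'(\alpha))^{1/\lambda}}\right)^{2\lambda}d\mu .$$ Then $0<t_*\le+\infty$, with $t_*=+\infty$ if and only if $\lambda\in(0,1]$. Let $u(x,t)$ be a classical solution, periodic in $x$ with period $1$ and defined for $t\in[0,t_*)$, of $$u_{xt}+uu_{xx}-\lambda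 u_x^2=-(\lambda+1)\int_0^1u_x^2\,dx\quad(t>0),\qquad u(x,0)=u_0(x),$$ where $u$ and $u_x$ are continuous for $0\le t<t_*$ and $u_x$ is $C^1$ in $(x,t)$ for $0<t<t_*$. Let $\gamma(\alpha,t)$ be its characteristics, $\dot\gamma(\alpha,t)=u(\gamma(\alpha,t),t)$, $\gamma(\alpha,0)=\alpha$. Then, for every $\alpha\in[0,1]$, the jacobian $\gamma_\alpha(\alpha,t)$ exists for all $t\in[0,t_*)$ and $$\lim_{t\uparrow t_*}\gamma_\alpha(\alpha,t)=\begin{cases}+\infty,&\alpha=\overline\alpha_i,\ \lambda\in(0,+\infty),\\ 0,&\alpha\neq\overline\alpha_i \text{ for all } i,\ \lambda\in(0,2],\\ C,&\alpha\neq\overline\alpha_i \text{ for all } i,\ \lambda\in(2,+\infty),\\ 0,&\alpha=\underline\alpha_j,\ \lambda\in(-\infty,0),\\ C,&\alpha\neq\underline\alpha_j\text{ for all } j,\ \lambda\in(-\infty,0),\end{cases}$$ where the positive constants $C$ depend only on $\lambda$, $\alpha$ and the initial datum $u_0$ (not on the solution $u$). -/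

import Mathlib

open Set Filter Topology
open scoped ContDiff

namespace ProudmanJohnson

noncomputable section

/-- The greatest value of `u₀'` on `[0,1]`. -/
def maxSlope (u0 : ℝ → ℝ) : ℝ := sSup (deriv u0 '' Icc 0 1)

/-- The least value of `u₀'` on `[0,1]`. -/
def minSlope (u0 : ℝ → ℝ) : ℝ := sInf (deriv u0 '' Icc 0 1)

/-- The points of `[0,1]` at which `u₀'` attains its greatest value. -/
def maxPoints (u0 : ℝ → ℝ) : Set ℝ := {a | a ∈ Icc (0 : ℝ) 1 ∧ deriv u0 a = maxSlope u0}

/-- The points of `[0,1]` at which `u₀'` attains its least value. -/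
def minPoints (u0 : ℝ → ℝ) : Set ℝ := {a | a ∈ Icc (0 : ℝ) 1 ∧ deriv u0 a = minSlope u0}

/-- `η_* = 1 / (λ M₀)` for `λ > 0` and `η_* = 1 / (λ m₀)` for `λ < 0`. -/
def etaStar (lam : ℝ) (u0 : ℝ → ℝ) : ℝ :=
  if 0 < lam then 1 / (lam * maxSlope u0) else 1 / (lam * minSlope u0)

/-- `t(η) = ∫₀^η (∫₀¹ (1 - λ μ u₀'(α))^(-1/λ) dα)^(2λ) dμ`. -/
def timeOfEta (lam : ℝ) (u0 : ℝ → ℝ) (η : ℝ) : ℝ :=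
  ∫ μ in (0 : ℝ)..η,
    (∫ a in (0 : ℝ)..1, 1 / (1 - lam * μ * deriv u0 a) ^ (1 / lam)) ^ (2 * lam)

/-- `t_* = lim_{η ↑ η_*} t(η)` as an extended real. The integrand of `t(η)` is positive for
`0 ≤ μ < η_*`, so that `t(η)` increases and the limit is the supremum over `[0, η_*)`. -/
def tStar (lam : ℝ) (u0 : ℝ → ℝ) : EReal :=
  ⨆ η ∈ Ico 0 (etaStar lam u0), ((timeOfEta lam u0 η : ℝ) : EReal)

/-- The filter `t ↑ T` on the real line, for `T` finite or `T = +∞`. -/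
def upTo (T : EReal) : Filter ℝ := comap (fun t : ℝ => (t : EReal)) (𝓝[<] T)

/-- The partial derivative `u_x(x,t)`. -/
def dx (u : ℝ → ℝ → ℝ) (x t : ℝ) : ℝ := deriv (fun y => u y t) x

/-- The partial derivative `u_t(x,t)`. -/
def dt (u : ℝ → ℝ → ℝ) (x t : ℝ) : ℝ := deriv (fun s => u x s) t

/-- `u = u(x,t)` is a classical solution on `0 ≤ t < T`, periodic in `x` with period one, of
`u_xt + u u_xx - λ u_x² = I(t)`, `I(t) = -(λ + 1) ∫₀¹ u_x² dx`, `u(x,0) = u₀(x)`. -/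
structure IsSolution (lam : ℝ) (u0 : ℝ → ℝ) (T : EReal) (u : ℝ → ℝ → ℝ) : Prop where
  periodic : ∀ t : ℝ, 0 ≤ t → (t : EReal) < T → ∀ x, u (x + 1) t = u x t
  continuousOn : ContinuousOn (fun p : ℝ × ℝ => u p.1 p.2)
    {p : ℝ × ℝ | 0 ≤ p.2 ∧ (p.2 : EReal) < T}
  differentiable : ∀ t : ℝ, 0 ≤ t → (t : EReal) < T → Differentiable ℝ (fun x => u x t)
  continuousOn_dx : ContinuousOn (fun p : ℝ × ℝ => dx u p.1 p.2)
    {p : ℝ × ℝ | 0 ≤ p.2 ∧ (p.2 : EReal) < T}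
  contDiffOn_dx : ContDiffOn ℝ 1 (fun p : ℝ × ℝ => dx u p.1 p.2)
    {p : ℝ × ℝ | 0 < p.2 ∧ (p.2 : EReal) < T}
  equation : ∀ t : ℝ, 0 < t → (t : EReal) < T → ∀ x,
    dt (dx u) x t + u x t * dx (dx u) x t - lam * dx u x t ^ 2
      = -(lam + 1) * ∫ y in (0 : ℝ)..1, dx u y t ^ 2
  initial : ∀ x, u x 0 = u0 x

/-- `γ = γ(α,t)` is the family of characteristics of `u` on `0 ≤ t < T`:
`∂γ/∂t (α,t) = u(γ(α,t),t)` (one-sided at `t = 0`) and `γ(α,0) = α`. -/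
structure IsCharacteristics (T : EReal) (u γ : ℝ → ℝ → ℝ) : Prop where
  initial : ∀ a, γ a 0 = a
  ode : ∀ a, ∀ t : ℝ, 0 ≤ t → (t : EReal) < T →
    HasDerivWithinAt (fun s => γ a s) (u (γ a t) t) (Ici 0) t

/-- The jacobian `γ_α(α,t)`. -/
def jacobian (γ : ℝ → ℝ → ℝ) (a t : ℝ) : ℝ := deriv (fun b => γ b t) a

end

end ProudmanJohnson

namespace ProudmanJohnson
open MeasureTheory

/-! Put `h = lam * u₀'` and let `κ` be its maximum, so that `η_* = κ⁻¹`. The slope `w = u_x` along a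
characteristic solves `w' = lam w² + I(t)` with a forcing common to all characteristics. Comparison
with a characteristic on which `u₀'` vanishes linearises this (`riccati_ratio`): if `P` is the time
integral of the reference slope and `η(t)` the integral of `exp (2 lam P)`, then `exp (-lam ∫ w) =
exp (-lam P) (1 - η h)`. Since `γ_α = exp (∫ w)` by `hasDerivAt_flow`, `γ_α = exp P · (1 - η
h)^(-1/lam)`. Periodicity gives `γ_α` mean one, which forces `exp (-P)` to be the mean of `(1 - η
h)^(-1/lam)`; hence `dt/dη` is that mean to the power `2 lam`, i.e. `t = timeOfEta η`. This is
`exists_eta`. The resulting formula involves the solution only through `η`, and `η ↑ κ⁻¹` as `t ↑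
t_*` (`tendsto_jacobian`).

It remains to study `(1 - μ h(α))^(-1/lam)` and its mean as `μ ↑ κ⁻¹`. For `lam > 0` the value at a
maximum dominates the mean (`tendsto_peak`). At other points the numerator converges, and everything
depends on the mean: it diverges for `lam ≤ 2` because `h` touches `κ` at least quadratically
(`tendsto_powMean_atTop`), and converges for `lam > 2` because nondegenerate contact makes `(κ -
h)^(-1/lam)` integrable (`tendsto_powMean_of_contact`). For `lam < 0` the exponent is positive and
nothing is singular. The same contact estimates decide whether `t_*` is finite:
`tendsto_time_atTop`, `exists_time_bound_of_one_lt`, `exists_time_bound_of_nonneg`. -/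

/-! ### Scalar flows and Riccati equations -/

theorem eq_of_hasDerivAt_zero {f : ℝ → ℝ} {t : ℝ} (ht : 0 ≤ t) (hc : ContinuousOn f (Icc 0 t))
    (hd : ∀ s ∈ Ioo 0 t, HasDerivAt f 0 s) : f t = f 0 := by
  rcases ht.eq_or_lt with rfl | ht
  · rfl
  obtain ⟨c, -, h⟩ := exists_hasDerivAt_eq_slope f (fun _ => 0) ht hc hd
  have h' := (div_eq_zero_iff.1 h.symm).resolve_right (by linarith)
  linarith

/-- The integral form is used because an averaged derivative depends continuously on the endpoints,
whereas an intermediate point need not. -/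
theorem integral_mean_value {f f' : ℝ → ℝ} (hf : ∀ x, HasDerivAt f (f' x) x)
    (hf' : Continuous f') (x y : ℝ) :
    f x - f y = (x - y) * ∫ θ in (0 : ℝ)..1, f' (y + θ * (x - y)) := by
  have h := intervalIntegral.integral_eq_sub_of_hasDerivAt (a := 0) (b := 1)
    (f := fun θ : ℝ => f (y + θ * (x - y))) (f' := fun θ => f' (y + θ * (x - y)) * (x - y))
    (fun θ _ => by
      have h1 : HasDerivAt (fun θ : ℝ => y + θ * (x - y)) (x - y) θ := by
        simpa using ((hasDerivAt_id θ).mul_const (x - y)).const_add y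
      exact (hf _).comp θ h1)
    (Continuous.intervalIntegrable (by fun_prop) _ _)
  rw [intervalIntegral.integral_mul_const] at h
  simp only [one_mul, zero_mul, add_zero, add_sub_cancel] at h
  linarith

/-- Two trajectories of a scalar flow differ by their initial distance times an exponential. -/
theorem trajectory_sub {v V : ℝ → ℝ → ℝ} {x y : ℝ → ℝ} {t : ℝ} (ht : 0 ≤ t)
    (hV : Continuous (Function.uncurry V))
    (hv : ∀ s ∈ Icc 0 t, ∀ z, HasDerivAt (fun z => v z s) (V z s) z)
    (hx : Continuous x) (hy : Continuous y)
    (hxd : ∀ s ∈ Ioo 0 t, HasDerivAt x (v (x s) s) s)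
    (hyd : ∀ s ∈ Ioo 0 t, HasDerivAt y (v (y s) s) s) :
    x t - y t = (x 0 - y 0) * Real.exp (∫ s in (0 : ℝ)..t,
      ∫ θ in (0 : ℝ)..1, V (y s + θ * (x s - y s)) s) := by
  set m : ℝ → ℝ := fun s => ∫ θ in (0 : ℝ)..1, V (y s + θ * (x s - y s)) s with hm
  have hmc : Continuous m := by
    apply intervalIntegral.continuous_parametric_intervalIntegral_of_continuous'
    exact hV.comp (f := fun p : ℝ × ℝ => (y p.1 + p.2 * (x p.1 - y p.1), p.1)) (by fun_prop)
  have hMd : ∀ s, HasDerivAt (fun s => ∫ r in (0 : ℝ)..s, m r) (m s) s := fun s =>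
    hmc.integral_hasStrictDerivAt 0 s |>.hasDerivAt
  have hMc : Continuous fun s => ∫ r in (0 : ℝ)..s, m r :=
    continuous_iff_continuousAt.2 fun s => (hMd s).continuousAt
  -- The difference divided by its integrating factor is constant. Derivatives at interior times are
  -- enough, which matters because the equation is imposed only for positive times.
  have key := eq_of_hasDerivAt_zero (f := fun s =>
    (x s - y s) * Real.exp (-∫ r in (0 : ℝ)..s, m r)) ht (by fun_prop) (by
      intro s hs
      have h1 := ((hxd s hs).sub (hyd s hs)).mul (hMd s).neg.exp
      have h2 := integral_mean_value (hv s ⟨hs.1.le, hs.2.le⟩)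
        (hV.comp (f := fun z => (z, s)) (by fun_prop)) (x s) (y s)
      refine h1.congr_deriv ?_
      simp only [Pi.sub_apply]
      rw [h2]
      ring)
  simp only [intervalIntegral.integral_same, neg_zero, Real.exp_zero, mul_one] at key
  rw [← key, mul_assoc, ← Real.exp_add]
  simp

/-- The flow of a scalar field is differentiable in the initial position. -/
theorem hasDerivAt_flow {v V X : ℝ → ℝ → ℝ} {t B : ℝ} (ht : 0 ≤ t)
    (hV : Continuous (Function.uncurry V)) (hB : ∀ z s, |V z s| ≤ B)
    (hv : ∀ s ∈ Icc 0 t, ∀ z, HasDerivAt (fun z => v z s) (V z s) z)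
    (hX : ∀ a, Continuous (X a)) (hX0 : ∀ a, X a 0 = a)
    (hXd : ∀ a, ∀ s ∈ Ioo 0 t, HasDerivAt (X a) (v (X a s) s) s) (a : ℝ) :
    HasDerivAt (fun b => X b t) (Real.exp (∫ s in (0 : ℝ)..t, V (X a s) s)) a := by
  -- The difference quotient of the flow is exactly `exp (∫ m b)`, with `m b` the slope averaged
  -- over the chord between the two trajectories; dominated convergence then lets `b → a`.
  set m : ℝ → ℝ → ℝ := fun b s => ∫ θ in (0 : ℝ)..1, V (X a s + θ * (X b s - X a s)) s with hm
  have hmB : ∀ b s, |m b s| ≤ B := by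
    intro b s
    have := intervalIntegral.norm_integral_le_of_norm_le_const (a := 0) (b := 1) (C := B)
      (f := fun θ => V (X a s + θ * (X b s - X a s)) s) (fun θ _ => hB _ _)
    simpa using this
  have hmc : ∀ b, Continuous (m b) := by
    intro b
    have := hX a
    have := hX b
    apply intervalIntegral.continuous_parametric_intervalIntegral_of_continuous'
    exact hV.comp (f := fun p : ℝ × ℝ => (X a p.1 + p.2 * (X b p.1 - X a p.1), p.1))
      (by fun_prop)
  have hsub : ∀ s ∈ Icc 0 t, ∀ b, X b s - X a s = (b - a) * Real.exp (∫ r in (0 : ℝ)..s, m b r) := by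
    intro s hs b
    have := trajectory_sub (t := s) hs.1 hV (fun r hr => hv r ⟨hr.1, hr.2.trans hs.2⟩) (hX b) (hX a)
      (fun r hr => hXd b r ⟨hr.1, hr.2.trans_le hs.2⟩) (fun r hr => hXd a r ⟨hr.1, hr.2.trans_le hs.2⟩)
    rwa [hX0, hX0] at this
  have hB0 : 0 ≤ B := (abs_nonneg _).trans (hB 0 0)
  have hlim : ∀ s ∈ Icc 0 t, Tendsto (fun b => X b s) (𝓝 a) (𝓝 (X a s)) := by
    intro s hs
    rw [tendsto_iff_norm_sub_tendsto_zero]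
    have h0 : Tendsto (fun b => |b - a| * Real.exp (B * s)) (𝓝 a) (𝓝 0) := by
      have : Continuous fun b => |b - a| * Real.exp (B * s) := by fun_prop
      simpa using this.tendsto a
    refine squeeze_zero (fun _ => norm_nonneg _) (fun b => ?_) h0
    rw [hsub s hs b, norm_mul, Real.norm_eq_abs, Real.norm_eq_abs, Real.abs_exp]
    gcongr
    have := intervalIntegral.norm_integral_le_of_norm_le_const (a := 0) (b := s) (C := B)
      (f := m b) (fun θ _ => hmB _ _)
    rw [sub_zero, abs_of_nonneg hs.1] at this
    exact (le_abs_self _).trans this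
  have hmlim : ∀ s ∈ Icc 0 t, Tendsto (fun b => m b s) (𝓝 a) (𝓝 (V (X a s) s)) := by
    intro s hs
    have hc : Continuous fun d : ℝ => ∫ θ in (0 : ℝ)..1, V (X a s + θ * (d - X a s)) s := by
      apply intervalIntegral.continuous_parametric_intervalIntegral_of_continuous'
      exact hV.comp (f := fun p : ℝ × ℝ => (X a s + p.2 * (p.1 - X a s), s)) (by fun_prop)
    have h1 := (hc.tendsto (X a s)).comp (hlim s hs)
    simpa [Function.comp_def] using h1
  have hI : Tendsto (fun b => ∫ s in (0 : ℝ)..t, m b s) (𝓝 a)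
      (𝓝 (∫ s in (0 : ℝ)..t, V (X a s) s)) := by
    apply intervalIntegral.tendsto_integral_filter_of_dominated_convergence (fun _ => B)
    · exact Eventually.of_forall fun b => (hmc b).aestronglyMeasurable
    · exact Eventually.of_forall fun b => Eventually.of_forall fun s _ => hmB b s
    · simp
    · refine Eventually.of_forall fun s hs => hmlim s ?_
      rw [uIoc_of_le ht] at hs
      exact ⟨hs.1.le, hs.2⟩
  rw [hasDerivAt_iff_tendsto_slope]
  refine Tendsto.congr' ?_ (((Real.continuous_exp.tendsto _).comp hI).mono_left nhdsWithin_le_nhds)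
  filter_upwards [self_mem_nhdsWithin] with b hb
  rw [slope_def_field, hsub t ⟨ht, le_rfl⟩ b]
  have : b - a ≠ 0 := sub_ne_zero.2 hb
  simp only [Function.comp]
  field_simp

/-- Two solutions of the Riccati equation `w' = lam w² + I` with the same forcing. -/
theorem riccati_ratio {lam t : ℝ} (ht : 0 ≤ t) {w w0 I : ℝ → ℝ} (hw : Continuous w)
    (hw0 : Continuous w0)
    (hwd : ∀ s ∈ Ioo 0 t, HasDerivAt w (lam * w s ^ 2 + I s) s)
    (hw0d : ∀ s ∈ Ioo 0 t, HasDerivAt w0 (lam * w0 s ^ 2 + I s) s) (h0 : w0 0 = 0) :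
    Real.exp (-lam * ∫ r in (0 : ℝ)..t, w r) = Real.exp (-lam * ∫ r in (0 : ℝ)..t, w0 r) *
      (1 - lam * (∫ s in (0 : ℝ)..t, Real.exp (2 * lam * ∫ r in (0 : ℝ)..s, w0 r)) * w 0) := by
  have hP : ∀ {f : ℝ → ℝ}, Continuous f →
      ∀ s, HasDerivAt (fun s => ∫ r in (0 : ℝ)..s, f r) (f s) s := fun hf s =>
    hf.integral_hasStrictDerivAt 0 s |>.hasDerivAt
  have hPc : ∀ {f : ℝ → ℝ}, Continuous f → Continuous fun s => ∫ r in (0 : ℝ)..s, f r :=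
    fun hf => continuous_iff_continuousAt.2 fun s => (hP hf s).continuousAt
  set W : ℝ → ℝ := fun s => ∫ r in (0 : ℝ)..s, w r with hW
  set W0 : ℝ → ℝ := fun s => ∫ r in (0 : ℝ)..s, w0 r with hW0
  have hWc : Continuous W := hPc hw
  have hW0c : Continuous W0 := hPc hw0
  have hWd : ∀ s, HasDerivAt W (w s) s := hP hw
  have hW0d : ∀ s, HasDerivAt W0 (w0 s) s := hP hw0
  have hE : Continuous fun s => Real.exp (2 * lam * W0 s) := by fun_prop
  have hEc := hPc hE
  -- conservation of the Wronskian
  have wron : ∀ s ∈ Icc 0 t, Real.exp (-lam * W s) * Real.exp (-lam * W0 s) * (w s - w0 s) = w 0 := by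
    intro s hs
    have := eq_of_hasDerivAt_zero (t := s) (f := fun s =>
      Real.exp (-lam * W s) * Real.exp (-lam * W0 s) * (w s - w0 s)) hs.1 (by fun_prop) (by
        intro r hr
        have hr' : r ∈ Ioo 0 t := ⟨hr.1, hr.2.trans_le hs.2⟩
        have := ((((hWd r).const_mul (-lam)).exp).mul (((hW0d r).const_mul (-lam)).exp)).mul
          ((hwd r hr').sub (hw0d r hr'))
        refine this.congr_deriv ?_
        simp only [Pi.mul_apply, Pi.sub_apply]
        ring)
    rw [this]
    simp [hW, hW0, h0]
  -- By the Wronskian identity the derivative of `exp (-lam (W - W0))` equals `-lam w(0) exp (2 lam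
  -- W0)`, whose primitive is explicit.
  have key := eq_of_hasDerivAt_zero (t := t) (f := fun s =>
      Real.exp (-lam * W s) * Real.exp (lam * W0 s) +
        lam * (∫ s in (0 : ℝ)..s, Real.exp (2 * lam * W0 s)) * w 0) ht (by fun_prop) (by
        intro r hr
        have := ((((hWd r).const_mul (-lam)).exp).mul (((hW0d r).const_mul lam).exp)).add
          (((hP hE r).const_mul lam).mul_const (w 0))
        refine this.congr_deriv ?_
        rw [← wron r ⟨hr.1.le, hr.2.le⟩]
        have e1 : Real.exp (2 * lam * W0 r) * Real.exp (-lam * W0 r) = Real.exp (lam * W0 r) := by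
          rw [← Real.exp_add]; congr 1; ring
        linear_combination (lam * Real.exp (-lam * W r) * (w r - w0 r)) * e1)
  simp only [intervalIntegral.integral_same] at key
  have e2 : Real.exp (-lam * W0 t) * Real.exp (lam * W0 t) = 1 := by
    rw [← Real.exp_add]; simp
  have e3 : W 0 = 0 := by simp [hW]
  have e4 : W0 0 = 0 := by simp [hW0]
  rw [e3, e4] at key
  simp only [mul_zero, Real.exp_zero, zero_mul, add_zero, mul_one] at key
  rw [← key]
  linear_combination (-Real.exp (-lam * W t)) * e2

/-! ### The mean of a power and the new time -/

/-- The mean over one period of `(1 - μ h)^r`. -/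
noncomputable def powMean (r : ℝ) (h : ℝ → ℝ) (μ : ℝ) : ℝ :=
  ∫ a in (0 : ℝ)..1, (1 - μ * h a) ^ r

/-- The alternative serves both signs of `lam`: a nonvanishing base before `κ⁻¹`, or a nonnegative
exponent, which allows `κ⁻¹` itself. -/
theorem continuousOn_powMean (r : ℝ) {h : ℝ → ℝ} (hh : Continuous h) {S : Set ℝ}
    (hS : ∀ μ ∈ S, ∀ a, 1 - μ * h a ≠ 0 ∨ 0 ≤ r) : ContinuousOn (powMean r h) S := by
  rw [continuousOn_iff_continuous_domRestrict]
  change Continuous fun μ : S => ∫ a in (0 : ℝ)..1, (1 - (μ : ℝ) * h a) ^ r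
  apply intervalIntegral.continuous_parametric_intervalIntegral_of_continuous'
  rw [continuous_iff_continuousAt]
  rintro ⟨⟨μ, hμ⟩, a⟩
  have h1 : Continuous fun p : S × ℝ => 1 - (p.1 : ℝ) * h p.2 := by fun_prop
  exact h1.continuousAt.rpow_const (hS μ hμ a)

theorem powMean_pos (r : ℝ) {h : ℝ → ℝ} (hh : Continuous h) {μ : ℝ}
    (hμ : ∀ a, 0 < 1 - μ * h a) : 0 < powMean r h μ := by
  apply intervalIntegral.intervalIntegral_pos_of_pos_on
  · apply Continuous.intervalIntegrable
    exact (by fun_prop : Continuous fun a => 1 - μ * h a).rpow_const fun a => Or.inl (hμ a).ne'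
  · exact fun a _ => Real.rpow_pos_of_pos (hμ a) r
  · norm_num

theorem timeOfEta_eq (lam : ℝ) (u0 : ℝ → ℝ) {η : ℝ} (hη : 0 ≤ η)
    (hJ : ∀ μ ∈ Icc 0 η, ∀ a, 0 < 1 - μ * (lam * deriv u0 a)) :
    timeOfEta lam u0 η =
      ∫ μ in (0 : ℝ)..η, powMean (-1 / lam) (fun a => lam * deriv u0 a) μ ^ (2 * lam) := by
  unfold timeOfEta powMean
  apply intervalIntegral.integral_congr
  intro μ hμ
  rw [uIcc_of_le hη] at hμ
  simp only
  congr 1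
  apply intervalIntegral.integral_congr
  intro a _
  have h1 : 1 - lam * μ * deriv u0 a = 1 - μ * (lam * deriv u0 a) := by ring
  simp only [h1, neg_div]
  rw [Real.rpow_neg (hJ μ hμ a).le, one_div]

/-! ### Representation of the jacobian -/

section Dynamics

variable {lam : ℝ} {u0 : ℝ → ℝ} {T : EReal} {u γ : ℝ → ℝ → ℝ}

theorem IsSolution.dx_periodic (hu : IsSolution lam u0 T u) {s : ℝ} (hs : 0 ≤ s)
    (hsT : (s : EReal) < T) : Function.Periodic (fun x => dx u x s) 1 := by
  intro x
  have h1 : (fun y => u (y + 1) s) = fun y => u y s := funext fun y => hu.periodic s hs hsT y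
  have h2 := deriv_comp_add_const (fun y => u y s) 1 x
  rw [h1] at h2
  exact h2.symm

theorem IsSolution.dx_zero (hu : IsSolution lam u0 T u) (x : ℝ) : dx u x 0 = deriv u0 x := by
  have : (fun y => u y 0) = u0 := funext hu.initial
  simp [dx, this]

/-- The slope `u_x` along a characteristic satisfies a Riccati equation. -/
theorem riccati_along (hu : IsSolution lam u0 T u) (hγ : IsCharacteristics T u γ) {s : ℝ}
    (hs : 0 < s) (hsT : (s : EReal) < T) (a : ℝ) :
    HasDerivAt (fun r => dx u (γ a r) r) (lam * dx u (γ a s) s ^ 2 +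
      -(lam + 1) * ∫ y in (0 : ℝ)..1, dx u y s ^ 2) s := by
  have hopen : IsOpen {p : ℝ × ℝ | 0 < p.2 ∧ (p.2 : EReal) < T} :=
    (isOpen_lt continuous_const continuous_snd).inter
      (isOpen_lt (continuous_coe_real_ereal.comp continuous_snd) continuous_const)
  have hd : DifferentiableAt ℝ (fun p : ℝ × ℝ => dx u p.1 p.2) (γ a s, s) :=
    (hu.contDiffOn_dx.contDiffAt (hopen.mem_nhds ⟨hs, hsT⟩)).differentiableAt (by norm_num)
  have hL := hd.hasFDerivAt
  set L := fderiv ℝ (fun p : ℝ × ℝ => dx u p.1 p.2) (γ a s, s)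
  have hγd : HasDerivAt (γ a) (u (γ a s) s) s :=
    (hγ.ode a s hs.le hsT).hasDerivAt (Ici_mem_nhds hs)
  have h1 : HasDerivAt (fun r => dx u (γ a r) r) (L (u (γ a s) s, 1)) s :=
    hL.comp_hasDerivAt s (f := fun r => (γ a r, r)) (hγd.prodMk (hasDerivAt_id s))
  have h2 : HasDerivAt (fun x => dx u x s) (L (1, 0)) (γ a s) :=
    hL.comp_hasDerivAt (γ a s) (f := fun x => (x, s))
      ((hasDerivAt_id _).prodMk (hasDerivAt_const _ _))
  have h3 : HasDerivAt (fun r => dx u (γ a s) r) (L (0, 1)) s :=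
    hL.comp_hasDerivAt s (f := fun r => (γ a s, r))
      ((hasDerivAt_const _ _).prodMk (hasDerivAt_id _))
  have heq := hu.equation s hs hsT (γ a s)
  have e2 : dx (dx u) (γ a s) s = L (1, 0) := h2.deriv
  have e3 : dt (dx u) (γ a s) s = L (0, 1) := h3.deriv
  refine h1.congr_deriv ?_
  -- The direction of the characteristic splits so that `L` yields `u u_xx + u_xt`, the left side of
  -- the equation.
  have e1 : ((u (γ a s) s, 1) : ℝ × ℝ) = u (γ a s) s • ((1, 0) : ℝ × ℝ) + (0, 1) := by
    simp
  rw [e1, map_add, map_smul, smul_eq_mul, ← e2, ← e3]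
  linarith

theorem exists_deriv_eq_zero_of_periodic (hs : ContDiff ℝ ∞ u0) (hper : ∀ x, u0 (x + 1) = u0 x) :
    ∃ a, deriv u0 a = 0 := by
  obtain ⟨c, -, hc⟩ := exists_deriv_eq_zero (f := u0) (a := 0) (b := 1) (by norm_num)
    hs.continuous.continuousOn (by have := hper 0; simp at this; exact this.symm)
  exact ⟨c, hc⟩

/-- The jacobian in terms of the initial slope and a new time `e`. -/
theorem exists_eta (hlam : lam ≠ 0) (hsm : ContDiff ℝ ∞ u0) (hper : ∀ x, u0 (x + 1) = u0 x)
    (hu : IsSolution lam u0 T u) (hγ : IsCharacteristics T u γ) {t : ℝ} (ht : 0 ≤ t)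
    (htT : (t : EReal) < T) :
    ∃ e, 0 ≤ e ∧ (∀ a, 0 < 1 - e * (lam * deriv u0 a)) ∧ timeOfEta lam u0 e = t ∧
      ∀ a, HasDerivAt (fun b => γ b t) ((1 - e * (lam * deriv u0 a)) ^ (-1 / lam) /
        powMean (-1 / lam) (fun a => lam * deriv u0 a) e) a := by
  have hg : Continuous (deriv u0) := hsm.continuous_deriv (by simp)
  -- Clamping time to `[0,t]` makes the field and the trajectories continuous on the whole line
  -- without changing them on `[0,t]`.
  set c : ℝ → ℝ := fun s => max 0 (min s t) with hc
  have hcc : Continuous c := by fun_prop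
  have hc0 : ∀ s, 0 ≤ c s := fun s => le_max_left _ _
  have hct : ∀ s, c s ≤ t := fun s => max_le ht (min_le_right _ _)
  have hcid : ∀ s ∈ Icc 0 t, c s = s := fun s hs => by
    simp [hc, min_eq_left hs.2, max_eq_right hs.1]
  have hlt : ∀ {s : ℝ}, s ≤ t → (s : EReal) < T := fun hs =>
    (EReal.coe_le_coe_iff.2 hs).trans_lt htT
  set V : ℝ → ℝ → ℝ := fun x s => dx u x (c s) with hVdef
  have hV : Continuous (Function.uncurry V) :=
    hu.continuousOn_dx.comp_continuous (f := fun p : ℝ × ℝ => (p.1, c p.2)) (by fun_prop)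
      fun p => ⟨hc0 _, hlt (hct _)⟩
  obtain ⟨B, hB⟩ : ∃ B, ∀ z s, |V z s| ≤ B := by
    obtain ⟨B, hB⟩ := (isCompact_Icc.prod isCompact_Icc :
      IsCompact (Icc (0 : ℝ) 1 ×ˢ Icc 0 t)).exists_bound_of_continuousOn hV.continuousOn
    refine ⟨B, fun z s => ?_⟩
    obtain ⟨y, hy, hyz⟩ :=
      (hu.dx_periodic (hc0 s) (hlt (hct s))).exists_mem_Ico₀ one_pos z
    have h1 := hB (y, c s) ⟨⟨hy.1, hy.2.le⟩, ⟨hc0 s, hct s⟩⟩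
    simp only [Function.uncurry, hVdef, hcid (c s) ⟨hc0 s, hct s⟩] at h1
    simp only [hVdef]
    rw [show dx u z (c s) = dx u y (c s) from hyz]
    exact h1
  have hv : ∀ s ∈ Icc 0 t, ∀ z, HasDerivAt (fun z => u z s) (V z s) z := by
    intro s hs z
    simp only [hVdef, hcid s hs]
    exact (hu.differentiable s hs.1 (hlt hs.2) z).hasDerivAt
  set X : ℝ → ℝ → ℝ := fun a s => γ a (c s) with hXdef
  have hX : ∀ a, Continuous (X a) := by
    intro a
    have h1 : ContinuousOn (γ a) (Icc 0 t) := fun s hs =>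
      (hγ.ode a s hs.1 (hlt hs.2)).continuousWithinAt.mono fun r hr => hr.1
    exact h1.comp_continuous hcc fun s => ⟨hc0 s, hct s⟩
  have hX0 : ∀ a, X a 0 = a := fun a => by
    simp only [hXdef, hcid 0 ⟨le_rfl, ht⟩, hγ.initial]
  have hev : ∀ s ∈ Ioo 0 t, ∀ᶠ r in 𝓝 s, c r = r := fun s hs => by
    filter_upwards [Ioo_mem_nhds hs.1 hs.2] with r hr using hcid r ⟨hr.1.le, hr.2.le⟩
  have hXd : ∀ a, ∀ s ∈ Ioo 0 t, HasDerivAt (X a) (u (X a s) s) s := by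
    intro a s hs
    have h1 : HasDerivAt (γ a) (u (γ a s) s) s :=
      (hγ.ode a s hs.1.le (hlt hs.2.le)).hasDerivAt (Ici_mem_nhds hs.1)
    have h2 : X a s = γ a s := by simp only [hXdef, hcid s ⟨hs.1.le, hs.2.le⟩]
    rw [h2]
    refine h1.congr_of_eventuallyEq ?_
    filter_upwards [hev s hs] with r hr
    simp only [hXdef, hr]
  set W : ℝ → ℝ → ℝ := fun a s => V (X a s) s with hWdef
  have hW : ∀ a, Continuous (W a) := fun a =>
    hV.comp (f := fun s => (X a s, s)) ((hX a).prodMk continuous_id)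
  have hWd : ∀ a, ∀ s ∈ Ioo 0 t, HasDerivAt (W a) (lam * W a s ^ 2 +
      -(lam + 1) * ∫ y in (0 : ℝ)..1, dx u y s ^ 2) s := by
    intro a s hs
    have h1 := riccati_along hu hγ hs.1 (hlt hs.2.le) a
    have h2 : W a s = dx u (γ a s) s := by
      simp only [hWdef, hVdef, hXdef, hcid s ⟨hs.1.le, hs.2.le⟩]
    rw [h2]
    refine h1.congr_of_eventuallyEq ?_
    filter_upwards [hev s hs] with r hr
    simp only [hWdef, hVdef, hXdef, hr]
  have hW0 : ∀ a, W a 0 = deriv u0 a := by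
    intro a
    simp only [hWdef, hVdef, hX0, hcid 0 ⟨le_rfl, ht⟩, hu.dx_zero]
  -- The reference characteristic: its initial slope is zero, as `riccati_ratio` requires.
  obtain ⟨a0, ha0⟩ := exists_deriv_eq_zero_of_periodic hsm hper
  set P : ℝ → ℝ := fun s => ∫ r in (0 : ℝ)..s, W a0 r with hP
  have hPc : Continuous P := continuous_iff_continuousAt.2 fun s =>
    ((hW a0).integral_hasStrictDerivAt 0 s).hasDerivAt.continuousAt
  have hEc : Continuous fun s => Real.exp (2 * lam * P s) := by fun_prop
  set E : ℝ → ℝ := fun s => ∫ r in (0 : ℝ)..s, Real.exp (2 * lam * P r) with hE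
  have hEd : ∀ s, HasDerivAt E (Real.exp (2 * lam * P s)) s := fun s =>
    (hEc.integral_hasStrictDerivAt 0 s).hasDerivAt
  have hE0 : ∀ s, 0 ≤ s → 0 ≤ E s := fun s hs =>
    intervalIntegral.integral_nonneg hs fun r _ => (Real.exp_pos _).le
  have hrat : ∀ s ∈ Icc 0 t, ∀ a, Real.exp (-lam * ∫ r in (0 : ℝ)..s, W a r) =
      Real.exp (-lam * P s) * (1 - E s * (lam * deriv u0 a)) := by
    intro s hs a
    have := riccati_ratio (t := s) hs.1 (hW a) (hW a0)
      (fun r hr => hWd a r ⟨hr.1, hr.2.trans_le hs.2⟩)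
      (fun r hr => hWd a0 r ⟨hr.1, hr.2.trans_le hs.2⟩) (by rw [hW0, ha0])
    rw [hW0] at this
    rw [this]
    ring
  have hJ : ∀ s ∈ Icc 0 t, ∀ a, 0 < 1 - E s * (lam * deriv u0 a) := by
    intro s hs a
    have h1 := Real.exp_pos (-lam * ∫ r in (0 : ℝ)..s, W a r)
    rw [hrat s hs a] at h1
    exact pos_of_mul_pos_right h1 (Real.exp_pos _).le
  have hD : ∀ s ∈ Icc 0 t, ∀ a, HasDerivAt (fun b => γ b s)
      (Real.exp (P s) * (1 - E s * (lam * deriv u0 a)) ^ (-1 / lam)) a := by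
    intro s hs a
    have h1 := hasDerivAt_flow (t := s) hs.1 hV hB (fun r hr => hv r ⟨hr.1, hr.2.trans hs.2⟩) hX hX0
      (fun b r hr => hXd b r ⟨hr.1, hr.2.trans_le hs.2⟩) a
    have h2 : (fun b => X b s) = fun b => γ b s := by simp only [hXdef, hcid s hs]
    rw [h2] at h1
    refine h1.congr_deriv ?_
    have h3 := congrArg (fun z => z ^ (-1 / lam)) (hrat s hs a)
    rw [Real.mul_rpow (Real.exp_pos _).le (hJ s hs a).le, ← Real.exp_mul, ← Real.exp_mul] at h3
    have e1 : ∀ z : ℝ, -lam * z * (-1 / lam) = z := fun z => by field_simp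
    rwa [e1, e1] at h3
  -- Integrating the jacobian over a period gives `γ 1 - γ 0 = 1`, which determines the unknown
  -- factor `exp P`.
  have hK : ∀ s ∈ Icc 0 t,
      powMean (-1 / lam) (fun a => lam * deriv u0 a) (E s) = Real.exp (-P s) := by
    intro s hs
    have h1 := intervalIntegral.integral_eq_sub_of_hasDerivAt (a := 0) (b := 1)
      (fun a _ => hD s hs a) (by
        apply Continuous.intervalIntegrable
        exact continuous_const.mul ((by fun_prop : Continuous fun a =>
          1 - E s * (lam * deriv u0 a)).rpow_const fun a => Or.inl (hJ s hs a).ne'))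
    rw [intervalIntegral.integral_const_mul] at h1
    have h2 : γ 1 s - γ 0 s = 1 := by
      -- By periodicity of `u`, the translate of the trajectory from `0` is again a trajectory; it
      -- starts at `1`, so it coincides with `X 1`.
      have h3 := trajectory_sub (x := X 1) (y := fun r => X 0 r + 1) (t := s) hs.1 hV
        (fun r hr => hv r ⟨hr.1, hr.2.trans hs.2⟩) (hX 1) ((hX 0).add continuous_const)
        (fun r hr => hXd 1 r ⟨hr.1, hr.2.trans_le hs.2⟩)
        (fun r hr => by
          rw [hu.periodic r hr.1.le (hlt (hr.2.le.trans hs.2))]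
          exact (hXd 0 r ⟨hr.1, hr.2.trans_le hs.2⟩).add_const 1)
      rw [hX0, hX0] at h3
      simp only [zero_add, sub_self, zero_mul, hXdef, hcid s hs] at h3
      linarith
    rw [h2] at h1
    rw [Real.exp_neg]
    exact eq_inv_of_mul_eq_one_right h1
  refine ⟨E t, hE0 t ht, hJ t ⟨ht, le_rfl⟩, ?_, fun a => ?_⟩
  · have hEt : ∀ μ ∈ Icc 0 (E t), ∀ a, 0 < 1 - μ * (lam * deriv u0 a) := by
      intro μ hμ a
      have h1 := hJ t ⟨ht, le_rfl⟩ a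
      rcases le_total 0 (lam * deriv u0 a) with h2 | h2
      · have := mul_le_mul_of_nonneg_right hμ.2 h2
        linarith
      · have := mul_nonpos_of_nonneg_of_nonpos hμ.1 h2
        linarith
    rw [timeOfEta_eq lam u0 (hE0 t ht) hEt]
    -- After the substitution `μ = E s` the integrand is `exp (-2 lam P) * exp (2 lam P) = 1`.
    have h1 := intervalIntegral.integral_comp_mul_deriv' (a := 0) (b := t) (f := E)
      (g := fun μ => powMean (-1 / lam) (fun a => lam * deriv u0 a) μ ^ (2 * lam))
      (fun s _ => hEd s) hEc.continuousOn (by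
        rw [uIcc_of_le ht]
        have hpos : ∀ μ ∈ E '' Icc 0 t, ∀ a, 0 < 1 - μ * (lam * deriv u0 a) := by
          rintro _ ⟨s, hs, rfl⟩ a
          exact hJ s hs a
        refine ContinuousOn.rpow_const (continuousOn_powMean _ (by fun_prop)
          fun μ hμ a => Or.inl (hpos μ hμ a).ne') fun μ hμ => Or.inl ?_
        exact (powMean_pos _ (by fun_prop) (hpos μ hμ)).ne')
    have h2 : E 0 = 0 := by simp [hE]
    rw [h2] at h1
    rw [← h1]
    have h3 : ∫ s in (0 : ℝ)..t, ((fun μ => powMean (-1 / lam) (fun a => lam * deriv u0 a) μ ^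
        (2 * lam)) ∘ E) s * Real.exp (2 * lam * P s) = ∫ s in (0 : ℝ)..t, 1 := by
      apply intervalIntegral.integral_congr
      intro s hs
      rw [uIcc_of_le ht] at hs
      simp only [Function.comp, hK s hs]
      rw [← Real.exp_mul, ← Real.exp_add]
      simp only [Real.exp_eq_one_iff]
      ring
    rw [h3]
    simp
  · refine (hD t ⟨ht, le_rfl⟩ a).congr_deriv ?_
    rw [hK t ⟨ht, le_rfl⟩, Real.exp_neg, div_inv_eq_mul, mul_comm]

end Dynamics

/-! ### Lower bounds for the mean near the critical parameter -/

section Static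

variable {h : ℝ → ℝ} {κ : ℝ}

theorem mul_lt_one_of_mem {μ : ℝ} (hκ : 0 < κ) (hμ : μ < κ⁻¹) : 0 < 1 - μ * κ := by
  have := mul_lt_mul_of_pos_right hμ hκ
  rw [inv_mul_cancel₀ hκ.ne'] at this
  linarith

theorem one_sub_mul_le (hle : ∀ a, h a ≤ κ) {μ : ℝ} (hμ : 0 ≤ μ) (a : ℝ) :
    1 - μ * κ ≤ 1 - μ * h a := by
  have := mul_le_mul_of_nonneg_left (hle a) hμ
  linarith

theorem one_sub_mul_pos (hκ : 0 < κ) (hle : ∀ a, h a ≤ κ) {μ : ℝ} (hμ : μ ∈ Ico 0 κ⁻¹) (a : ℝ) :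
    0 < 1 - μ * h a :=
  (mul_lt_one_of_mem hκ hμ.2).trans_le (one_sub_mul_le hle hμ.1 a)

theorem eventually_mem_Ico (hκ : 0 < κ) : ∀ᶠ μ in 𝓝[<] κ⁻¹, μ ∈ Ico 0 κ⁻¹ :=
  Ico_mem_nhdsLT (inv_pos.2 hκ)

theorem tendsto_one_sub_mul (hκ : 0 < κ) :
    Tendsto (fun μ => 1 - μ * κ) (𝓝[<] κ⁻¹) (𝓝[>] 0) := by
  rw [tendsto_nhdsWithin_iff]
  constructor
  · have : Continuous fun μ => 1 - μ * κ := by fun_prop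
    have h1 := (this.tendsto κ⁻¹).mono_left (nhdsWithin_le_nhds (s := Iio κ⁻¹))
    rwa [inv_mul_cancel₀ hκ.ne', sub_self] at h1
  · filter_upwards [self_mem_nhdsWithin] with μ hμ using mul_lt_one_of_mem hκ hμ

theorem ae_lt_of_finite (hle : ∀ a, h a ≤ κ) (hfin : {a | a ∈ Icc (0 : ℝ) 1 ∧ h a = κ}.Finite) :
    ∀ᵐ a : ℝ, a ∈ Icc (0 : ℝ) 1 → h a < κ := by
  have h1 : ∀ᵐ a : ℝ, a ∉ {a | a ∈ Icc (0 : ℝ) 1 ∧ h a = κ} :=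
    measure_eq_zero_iff_ae_notMem.1 (hfin.measure_zero volume)
  filter_upwards [h1] with a ha ha'
  exact lt_of_le_of_ne (hle a) fun e => ha ⟨ha', e⟩

theorem continuous_one_sub_mul_rpow (hh : Continuous h) (r : ℝ) {μ : ℝ}
    (hμ : ∀ a, 0 < 1 - μ * h a) : Continuous fun a => (1 - μ * h a) ^ r :=
  (by fun_prop : Continuous fun a => 1 - μ * h a).rpow_const fun a => Or.inl (hμ a).ne'

/-- At an extremal point the power dominates its mean. -/
theorem tendsto_peak {r : ℝ} (hr : r < 0) (hh : Continuous h) (hκ : 0 < κ) (hle : ∀ a, h a ≤ κ)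
    (hfin : {a | a ∈ Icc (0 : ℝ) 1 ∧ h a = κ}.Finite) :
    Tendsto (fun μ => (1 - μ * κ) ^ r / powMean r h μ) (𝓝[<] κ⁻¹) atTop := by
  -- Normalised by its value at the peak, the integrand is at most `1` and tends to zero off the
  -- finite, hence null, contact set.
  have hI : Tendsto (fun μ => ∫ a in (0 : ℝ)..1, ((1 - μ * h a) / (1 - μ * κ)) ^ r)
      (𝓝[<] κ⁻¹) (𝓝 (∫ a in (0 : ℝ)..1, 0)) := by
    apply intervalIntegral.tendsto_integral_filter_of_dominated_convergence (fun _ => 1)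
    · filter_upwards [eventually_mem_Ico hκ] with μ hμ
      apply Continuous.aestronglyMeasurable
      refine (by fun_prop : Continuous fun a => (1 - μ * h a) / (1 - μ * κ)).rpow_const
        fun a => Or.inl (div_pos (one_sub_mul_pos hκ hle hμ a) (mul_lt_one_of_mem hκ hμ.2)).ne'
    · filter_upwards [eventually_mem_Ico hκ] with μ hμ
      refine Eventually.of_forall fun a _ => ?_
      have h1 := mul_lt_one_of_mem hκ hμ.2
      have h2 : 1 ≤ (1 - μ * h a) / (1 - μ * κ) :=
        (one_le_div h1).2 (one_sub_mul_le hle hμ.1 a)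
      rw [Real.norm_of_nonneg (Real.rpow_nonneg (by linarith) _)]
      exact Real.rpow_le_one_of_one_le_of_nonpos h2 hr.le
    · simp
    · filter_upwards [ae_lt_of_finite hle hfin] with a ha ha'
      rw [uIoc_of_le zero_le_one] at ha'
      have h1 := ha ⟨ha'.1.le, ha'.2⟩
      have h2 : 0 < 1 - κ⁻¹ * h a := by
        have := mul_lt_mul_of_pos_left h1 (inv_pos.2 hκ)
        rw [inv_mul_cancel₀ hκ.ne'] at this
        linarith
      have h3 : Tendsto (fun μ => 1 - μ * h a) (𝓝[<] κ⁻¹) (𝓝 (1 - κ⁻¹ * h a)) :=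
        ((by fun_prop : Continuous fun μ => 1 - μ * h a).tendsto _).mono_left nhdsWithin_le_nhds
      have h4 : Tendsto (fun μ => (1 - μ * h a) / (1 - μ * κ)) (𝓝[<] κ⁻¹) atTop := by
        simp only [div_eq_mul_inv]
        exact h3.pos_mul_atTop h2 (tendsto_inv_nhdsGT_zero.comp (tendsto_one_sub_mul hκ))
      have h5 := (tendsto_rpow_neg_atTop (neg_pos.2 hr)).comp h4
      simpa [Function.comp_def] using h5
  simp only [intervalIntegral.integral_zero] at hI
  have hpos : Tendsto (fun μ => ∫ a in (0 : ℝ)..1, ((1 - μ * h a) / (1 - μ * κ)) ^ r)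
      (𝓝[<] κ⁻¹) (𝓝[>] 0) := by
    rw [tendsto_nhdsWithin_iff]
    refine ⟨hI, ?_⟩
    filter_upwards [eventually_mem_Ico hκ] with μ hμ
    have h1 := mul_lt_one_of_mem hκ hμ.2
    have h2 : ∀ a, 0 < (1 - μ * h a) / (1 - μ * κ) := fun a =>
      div_pos (one_sub_mul_pos hκ hle hμ a) h1
    exact intervalIntegral.intervalIntegral_pos_of_pos_on
      (((by fun_prop : Continuous fun a => (1 - μ * h a) / (1 - μ * κ)).rpow_const
        fun a => Or.inl (h2 a).ne').intervalIntegrable _ _)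
      (fun a _ => Real.rpow_pos_of_pos (h2 a) r) one_pos
  refine Tendsto.congr' ?_ (tendsto_inv_nhdsGT_zero.comp hpos)
  filter_upwards [eventually_mem_Ico hκ] with μ hμ
  have h1 := mul_lt_one_of_mem hκ hμ.2
  have h2 : ∫ a in (0 : ℝ)..1, ((1 - μ * h a) / (1 - μ * κ)) ^ r =
      powMean r h μ / (1 - μ * κ) ^ r := by
    unfold powMean
    rw [← intervalIntegral.integral_div]
    congr 1
    funext a
    exact Real.div_rpow (one_sub_mul_pos hκ hle hμ a).le h1.le r
  simp only [Function.comp, h2, inv_div]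

/-- A quadratic contact at one extremal point bounds the mean from below. -/
theorem integral_le_powMean {r C a : ℝ} (hr : r ≤ 0) (hh : Continuous h) (hκ : 0 < κ)
    (hle : ∀ a, h a ≤ κ) (hC : 0 ≤ C) (ha : a ∈ Icc (0 : ℝ) 1)
    (hq : ∀ x ∈ Icc (0 : ℝ) 1, κ - h x ≤ C * (x - a) ^ 2) {μ : ℝ} (hμ : μ ∈ Ico 0 κ⁻¹) :
    ∫ y in (0 : ℝ)..1 / 2, ((1 - μ * κ) + C / κ * y ^ 2) ^ r ≤ powMean r h μ := by
  have h1 := mul_lt_one_of_mem hκ hμ.2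
  have hCκ : 0 ≤ C / κ := div_nonneg hC hκ.le
  have hpos : ∀ y : ℝ, 0 < (1 - μ * κ) + C / κ * y ^ 2 := fun y =>
    add_pos_of_pos_of_nonneg h1 (mul_nonneg hCκ (sq_nonneg _))
  have hcont : Continuous fun y : ℝ => ((1 - μ * κ) + C / κ * y ^ 2) ^ r :=
    (by fun_prop : Continuous fun y : ℝ => (1 - μ * κ) + C / κ * y ^ 2).rpow_const
      fun y => Or.inl (hpos y).ne'
  have hfc := continuous_one_sub_mul_rpow hh r (one_sub_mul_pos hκ hle hμ)
  have hpt : ∀ x ∈ Icc (0 : ℝ) 1,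
      ((1 - μ * κ) + C / κ * (x - a) ^ 2) ^ r ≤ (1 - μ * h x) ^ r := by
    intro x hx
    refine Real.rpow_le_rpow_of_nonpos (one_sub_mul_pos hκ hle hμ x) ?_ hr
    have h2 : μ * (κ - h x) ≤ κ⁻¹ * (C * (x - a) ^ 2) :=
      mul_le_mul hμ.2.le (hq x hx) (sub_nonneg.2 (hle x)) (inv_nonneg.2 hκ.le)
    have h3 : C / κ * (x - a) ^ 2 = κ⁻¹ * (C * (x - a) ^ 2) := by ring
    rw [h3]
    linarith
  have hsub : ∀ {b c : ℝ}, 0 ≤ b → b ≤ c → c ≤ 1 →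
      ∫ x in b..c, ((1 - μ * κ) + C / κ * (x - a) ^ 2) ^ r ≤ powMean r h μ := by
    intro b c hb hbc hc
    have hcont' : Continuous fun x : ℝ => ((1 - μ * κ) + C / κ * (x - a) ^ 2) ^ r :=
      hcont.comp (continuous_id.sub continuous_const)
    calc _ ≤ ∫ x in b..c, (1 - μ * h x) ^ r :=
          intervalIntegral.integral_mono_on hbc (hcont'.intervalIntegrable _ _)
            (hfc.intervalIntegrable _ _) fun x hx => hpt x ⟨hb.trans hx.1, hx.2.trans hc⟩
      _ ≤ _ := intervalIntegral.integral_mono_interval hb hbc hc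
          (Eventually.of_forall fun x =>
            Real.rpow_nonneg (one_sub_mul_pos hκ hle hμ x).le r) (hfc.intervalIntegrable _ _)
  -- At least one side of `a` leaves an interval of length `1 / 2` inside `[0,1]`.
  rcases le_total a (1 / 2) with ha2 | ha2
  · refine le_trans (le_of_eq ?_) (hsub (b := a) (c := a + 1 / 2) ha.1 (by linarith) (by linarith))
    have := intervalIntegral.integral_comp_sub_right (a := a) (b := a + 1 / 2)
      (fun y => ((1 - μ * κ) + C / κ * y ^ 2) ^ r) a
    rw [this]
    simp
  · refine le_trans (le_of_eq ?_) (hsub (b := a - 1 / 2) (c := a) (by linarith) (by linarith) ha.2)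
    have := intervalIntegral.integral_comp_sub_left (a := a - 1 / 2) (b := a)
      (fun y => ((1 - μ * κ) + C / κ * y ^ 2) ^ r) a
    rw [sub_self, sub_sub_cancel] at this
    rw [← this]
    congr 1
    funext x
    rw [← neg_sub x a, neg_sq]

/-- For `y` between `√(1 - μ κ)` and `1 / 2` the comparison integrand is at least a constant times
`y ^ (2 * r)`, hence times `y⁻¹`, and the integral grows logarithmically. The borderline `r = -1/2`,
that is `lam = 2`, is included. -/
theorem tendsto_powMean_atTop {r C a : ℝ} (hr : r ≤ -(1 / 2)) (hh : Continuous h) (hκ : 0 < κ)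
    (hle : ∀ a, h a ≤ κ) (hC : 0 ≤ C) (ha : a ∈ Icc (0 : ℝ) 1)
    (hq : ∀ x ∈ Icc (0 : ℝ) 1, κ - h x ≤ C * (x - a) ^ 2) :
    Tendsto (powMean r h) (𝓝[<] κ⁻¹) atTop := by
  set D := C / κ with hD
  have hD0 : 0 ≤ D := div_nonneg hC hκ.le
  have hsq : Tendsto (fun μ => Real.sqrt (1 - μ * κ)) (𝓝[<] κ⁻¹) (𝓝[>] 0) := by
    rw [tendsto_nhdsWithin_iff]
    have h1 := tendsto_nhdsWithin_iff.1 (tendsto_one_sub_mul hκ)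
    refine ⟨?_, h1.2.mono fun μ hμ => Real.sqrt_pos.2 hμ⟩
    simpa using h1.1.sqrt
  have hlog : Tendsto (fun μ => (1 + D) ^ r * Real.log (1 / 2 / Real.sqrt (1 - μ * κ)))
      (𝓝[<] κ⁻¹) atTop := by
    refine Tendsto.const_mul_atTop (Real.rpow_pos_of_pos (by linarith) r) ?_
    refine Real.tendsto_log_atTop.comp ?_
    simp only [div_eq_mul_inv]
    exact Tendsto.const_mul_atTop (by norm_num) (tendsto_inv_nhdsGT_zero.comp hsq)
  refine tendsto_atTop_mono' _ ?_ hlog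
  filter_upwards [eventually_mem_Ico hκ, hsq (Ioo_mem_nhdsGT (show (0 : ℝ) < 1 / 2 by norm_num))]
    with μ hμ hμ2
  obtain ⟨hs0, hs2⟩ := hμ2
  have h1 := mul_lt_one_of_mem hκ hμ.2
  refine le_trans ?_ (integral_le_powMean (by linarith) hh hκ hle hC ha hq hμ)
  set δ := Real.sqrt (1 - μ * κ) with hδ
  have hδ2 : δ ^ 2 = 1 - μ * κ := Real.sq_sqrt h1.le
  have hpos : ∀ y : ℝ, 0 < (1 - μ * κ) + D * y ^ 2 := fun y =>
    add_pos_of_pos_of_nonneg h1 (mul_nonneg hD0 (sq_nonneg _))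
  have hcont : Continuous fun y : ℝ => ((1 - μ * κ) + D * y ^ 2) ^ r :=
    (by fun_prop : Continuous fun y : ℝ => (1 - μ * κ) + D * y ^ 2).rpow_const
      fun y => Or.inl (hpos y).ne'
  calc (1 + D) ^ r * Real.log (1 / 2 / δ) = ∫ y in δ..1 / 2, (1 + D) ^ r * y⁻¹ := by
        rw [intervalIntegral.integral_const_mul, integral_inv_of_pos hs0 (by norm_num)]
    _ ≤ ∫ y in δ..1 / 2, ((1 - μ * κ) + D * y ^ 2) ^ r := by
        refine intervalIntegral.integral_mono_on hs2.le ?_ (hcont.intervalIntegrable _ _) ?_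
        · refine (intervalIntegral.intervalIntegrable_inv (fun y hy => ?_)
            continuousOn_id).const_mul _
          rw [uIcc_of_le hs2.le] at hy
          exact (hs0.trans_le hy.1).ne'
        · intro y hy
          have hy0 : 0 < y := hs0.trans_le hy.1
          have h2 : (1 - μ * κ) + D * y ^ 2 ≤ (1 + D) * y ^ 2 := by
            have := pow_le_pow_left₀ hs0.le hy.1 2
            rw [hδ2] at this
            linarith
          calc (1 + D) ^ r * y⁻¹ ≤ (1 + D) ^ r * (y ^ 2) ^ r := by
                refine mul_le_mul_of_nonneg_left ?_ (Real.rpow_nonneg (by linarith) r)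
                rw [← Real.rpow_neg_one, ← Real.rpow_natCast, ← Real.rpow_mul hy0.le]
                refine Real.rpow_le_rpow_of_exponent_ge hy0 (by linarith [hy.2]) ?_
                push_cast
                linarith
            _ = ((1 + D) * y ^ 2) ^ r := (Real.mul_rpow (by linarith) (sq_nonneg _)).symm
            _ ≤ _ := Real.rpow_le_rpow_of_nonpos (hpos y) h2 (by linarith)
    _ ≤ _ := intervalIntegral.integral_mono_interval hs0.le hs2.le le_rfl
        (Eventually.of_forall fun y => Real.rpow_nonneg (hpos y).le r)
        (hcont.intervalIntegrable _ _)

/-- With `ε = 1 - μ κ`, the range `y ≤ √ε` alone suffices: there the base is at most `(1 + C / κ)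
ε`, and the length contributes `ε ^ (1 / 2)`. The bound `ε ≤ 1 / 4` makes this range fit into `[0, 1
/ 2]`. -/
theorem powMean_lower {r C a : ℝ} (hr : r ≤ 0) (hh : Continuous h) (hκ : 0 < κ)
    (hle : ∀ a, h a ≤ κ) (hC : 0 ≤ C) (ha : a ∈ Icc (0 : ℝ) 1)
    (hq : ∀ x ∈ Icc (0 : ℝ) 1, κ - h x ≤ C * (x - a) ^ 2) {μ : ℝ} (hμ : μ ∈ Ico 0 κ⁻¹)
    (hμ2 : 1 - μ * κ ≤ 1 / 4) :
    (1 + C / κ) ^ r * (1 - μ * κ) ^ (1 / 2 + r) ≤ powMean r h μ := by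
  have h1 := mul_lt_one_of_mem hκ hμ.2
  refine le_trans ?_ (integral_le_powMean hr hh hκ hle hC ha hq hμ)
  set D := C / κ with hD
  have hD0 : 0 ≤ D := div_nonneg hC hκ.le
  set ε := 1 - μ * κ with hε
  have hpos : ∀ y : ℝ, 0 < ε + D * y ^ 2 := fun y =>
    add_pos_of_pos_of_nonneg h1 (mul_nonneg hD0 (sq_nonneg _))
  have hcont : Continuous fun y : ℝ => (ε + D * y ^ 2) ^ r :=
    (by fun_prop : Continuous fun y : ℝ => ε + D * y ^ 2).rpow_const
      fun y => Or.inl (hpos y).ne'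
  have hs2 : Real.sqrt ε ≤ 1 / 2 := by
    rw [Real.sqrt_le_left (by norm_num)]
    linarith
  calc (1 + D) ^ r * ε ^ (1 / 2 + r) = ∫ y in (0 : ℝ)..Real.sqrt ε, ((1 + D) * ε) ^ r := by
        rw [intervalIntegral.integral_const, sub_zero, smul_eq_mul, Real.rpow_add h1,
          ← Real.sqrt_eq_rpow, Real.mul_rpow (by linarith) h1.le]
        ring
    _ ≤ ∫ y in (0 : ℝ)..Real.sqrt ε, (ε + D * y ^ 2) ^ r := by
        refine intervalIntegral.integral_mono_on (Real.sqrt_nonneg _) (by simp)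
          (hcont.intervalIntegrable _ _) fun y hy => ?_
        refine Real.rpow_le_rpow_of_nonpos (hpos y) ?_ hr
        have h2 := pow_le_pow_left₀ hy.1 hy.2 2
        rw [Real.sq_sqrt h1.le] at h2
        have := mul_le_mul_of_nonneg_left h2 hD0
        linarith
    _ ≤ _ := intervalIntegral.integral_mono_interval le_rfl (Real.sqrt_nonneg _) hs2
        (Eventually.of_forall fun y => Real.rpow_nonneg (hpos y).le r)
        (hcont.intervalIntegrable _ _)

theorem continuousOn_powMean_rpow {r q : ℝ} (hh : Continuous h) (hκ : 0 < κ) (hle : ∀ a, h a ≤ κ) :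
    ContinuousOn (fun μ => powMean r h μ ^ q) (Ico 0 κ⁻¹) :=
  (continuousOn_powMean r hh fun _ hμ a => Or.inl (one_sub_mul_pos hκ hle hμ a).ne').rpow_const
    fun _ hμ => Or.inl (powMean_pos r hh (one_sub_mul_pos hκ hle hμ)).ne'

/-- For `0 < lam ≤ 1` the time integral diverges. -/
theorem tendsto_time_atTop {lam C a : ℝ} (hl0 : 0 < lam) (hl1 : lam ≤ 1) (hh : Continuous h)
    (hκ : 0 < κ) (hle : ∀ a, h a ≤ κ) (hC : 0 ≤ C) (ha : a ∈ Icc (0 : ℝ) 1)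
    (hq : ∀ x ∈ Icc (0 : ℝ) 1, κ - h x ≤ C * (x - a) ^ 2) :
    Tendsto (fun η => ∫ μ in (0 : ℝ)..η, powMean (-1 / lam) h μ ^ (2 * lam)) (𝓝[<] κ⁻¹) atTop := by
  have hr : -1 / lam ≤ 0 := div_nonpos_of_nonpos_of_nonneg (by norm_num) hl0.le
  set c : ℝ := ((1 + C / κ) ^ (-1 / lam)) ^ (2 * lam) with hc
  have hCκ : 0 ≤ C / κ := div_nonneg hC hκ.le
  have hc0 : 0 < c := Real.rpow_pos_of_pos (Real.rpow_pos_of_pos (by linarith) _) _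
  -- Beyond `η1` one has `1 - μ κ ≤ 1 / 4`, as `powMean_lower` demands.
  set η1 : ℝ := 3 / 4 * κ⁻¹ with hη1
  have hi := inv_pos.2 hκ
  have hη10 : 0 < η1 := by positivity
  have hη1κ : η1 * κ = 3 / 4 := by rw [hη1, mul_assoc, inv_mul_cancel₀ hκ.ne', mul_one]
  have hη1lt : η1 < κ⁻¹ := by linarith
  have hlog : Tendsto (fun η => c * (κ⁻¹ * (Real.log (1 - η1 * κ) - Real.log (1 - η * κ))))
      (𝓝[<] κ⁻¹) atTop := by
    refine Tendsto.const_mul_atTop hc0 (Tendsto.const_mul_atTop hi ?_)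
    simp only [sub_eq_add_neg (Real.log _)]
    refine tendsto_atTop_add_const_left _ _ ?_
    exact tendsto_neg_atBot_atTop.comp
      (Real.tendsto_log_nhdsGT_zero.comp (tendsto_one_sub_mul hκ))
  refine tendsto_atTop_mono' _ ?_ hlog
  filter_upwards [Ioo_mem_nhdsLT hη1lt] with η hη
  have hcont : ContinuousOn (fun μ => powMean (-1 / lam) h μ ^ (2 * lam)) (Icc 0 η) :=
    (continuousOn_powMean_rpow hh hκ hle).mono fun μ hμ => ⟨hμ.1, hμ.2.trans_lt hη.2⟩
  have hlt : ∀ μ ∈ Icc η1 η, 0 < 1 - μ * κ := fun μ hμ =>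
    mul_lt_one_of_mem hκ (hμ.2.trans_lt hη.2)
  have hcinv : ContinuousOn (fun μ => (1 - μ * κ)⁻¹) (Icc η1 η) :=
    ContinuousOn.inv₀ (by fun_prop) fun μ hμ => (hlt μ hμ).ne'
  have hprim : ∫ μ in η1..η, (1 - μ * κ)⁻¹ =
      κ⁻¹ * (Real.log (1 - η1 * κ) - Real.log (1 - η * κ)) := by
    have := intervalIntegral.integral_eq_sub_of_hasDerivAt (a := η1) (b := η)
      (f := fun μ => -(κ⁻¹ * Real.log (1 - μ * κ))) (f' := fun μ => (1 - μ * κ)⁻¹)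
      (fun μ hμ => by
        rw [uIcc_of_le hη.1.le] at hμ
        have h1 := hlt μ hμ
        have h2 : HasDerivAt (fun μ => 1 - μ * κ) (-κ) μ := by
          simpa using ((hasDerivAt_id μ).mul_const κ).const_sub 1
        refine ((h2.log h1.ne').const_mul κ⁻¹).neg.congr_deriv ?_
        field_simp)
      (ContinuousOn.intervalIntegrable (by rwa [uIcc_of_le hη.1.le]))
    rw [this]
    ring
  calc c * (κ⁻¹ * (Real.log (1 - η1 * κ) - Real.log (1 - η * κ)))
      = ∫ μ in η1..η, c * (1 - μ * κ)⁻¹ := by rw [intervalIntegral.integral_const_mul, hprim]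
    _ ≤ ∫ μ in η1..η, powMean (-1 / lam) h μ ^ (2 * lam) := by
        refine intervalIntegral.integral_mono_on hη.1.le ?_ ?_ ?_
        · exact (ContinuousOn.intervalIntegrable (by rwa [uIcc_of_le hη.1.le])).const_mul c
        · refine ContinuousOn.intervalIntegrable ?_
          rw [uIcc_of_le hη.1.le]
          exact hcont.mono (Icc_subset_Icc_left hη10.le)
        · intro μ hμ
          have hε := hlt μ hμ
          have hε4 : 1 - μ * κ ≤ 1 / 4 := by
            have := mul_le_mul_of_nonneg_right hμ.1 hκ.le
            linarith
          have h1 := powMean_lower hr hh hκ hle hC ha hq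
            ⟨hη10.le.trans hμ.1, hμ.2.trans_lt hη.2⟩ hε4
          have h2 : ((1 + C / κ) ^ (-1 / lam) * (1 - μ * κ) ^ (1 / 2 + -1 / lam)) ^ (2 * lam) ≤
              powMean (-1 / lam) h μ ^ (2 * lam) :=
            Real.rpow_le_rpow (mul_nonneg (Real.rpow_nonneg (by linarith) _)
              (Real.rpow_nonneg hε.le _)) h1 (by linarith)
          refine le_trans ?_ h2
          rw [Real.mul_rpow (Real.rpow_nonneg (by linarith) _) (Real.rpow_nonneg hε.le _), ← hc,
            ← Real.rpow_mul hε.le, ← Real.rpow_neg_one]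
          refine mul_le_mul_of_nonneg_left ?_ hc0.le
          refine Real.rpow_le_rpow_of_exponent_ge hε (by linarith) ?_
          -- The exponent `lam - 2` is at most `-1` precisely when `lam ≤ 1`: this is the threshold
          -- for an infinite `t_*`.
          have : (1 / 2 + -1 / lam) * (2 * lam) = lam - 2 := by field_simp; ring
          rw [this]
          linarith
    _ ≤ _ := by
        refine intervalIntegral.integral_mono_interval hη10.le hη.1.le le_rfl ?_ ?_
        · rw [EventuallyLE, ae_restrict_iff' measurableSet_Ioc]
          exact Eventually.of_forall fun μ hμ => Real.rpow_nonneg (powMean_pos _ hh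
            (one_sub_mul_pos hκ hle ⟨hμ.1.le, hμ.2.trans_lt hη.2⟩)).le _
        · refine ContinuousOn.intervalIntegrable ?_
          rwa [uIcc_of_le (hη10.le.trans hη.1.le)]

end Static

/-! ### Upper bounds for the mean and convergence of the time integral -/

theorem intervalIntegrable_abs_sub_rpow {r : ℝ} (hr : -1 < r) (c a b : ℝ) :
    IntervalIntegrable (fun x => |x - c| ^ r) volume a b := by
  have h1 : ∀ a b : ℝ, IntervalIntegrable (fun x => |x| ^ r) volume a b := fun a b =>
    intervalIntegrable_of_even (by simp) (fun x hx =>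
      (intervalIntegral.intervalIntegrable_rpow' (a := 0) (b := x) hr).congr (fun y hy => by
        rw [uIoc_of_le hx.le] at hy
        simp only [abs_of_pos hy.1]))
  have h2 := (h1 (a - c) (b - c)).comp_sub_right c
  simpa using h2

section Upper

variable {h : ℝ → ℝ} {κ : ℝ}

/-- A singularity with nondegenerate contact is integrable for small exponents. -/
theorem intervalIntegrable_contact {p : ℝ} (hp0 : 0 < p) (hp : p < 1 / 2) (hh : Continuous h)
    (hle : ∀ a, h a ≤ κ)
    (hnd : ∀ a ∈ Icc (0 : ℝ) 1, h a = κ → ∃ c > 0, ∀ᶠ x in 𝓝 a, c * (x - a) ^ 2 ≤ κ - h x) :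
    IntervalIntegrable (fun a => (κ - h a) ^ (-p)) volume 0 1 := by
  have hmeas : Measurable fun a => (κ - h a) ^ (-p) :=
    (by fun_prop : Continuous fun a => κ - h a).measurable.pow_const _
  rw [intervalIntegrable_iff_integrableOn_Icc_of_le zero_le_one]
  refine LocallyIntegrableOn.integrableOn_isCompact (fun a ha => ?_) isCompact_Icc
  suffices H : IntegrableAtFilter (fun a => (κ - h a) ^ (-p)) (𝓝 a) volume from
    H.filter_mono nhdsWithin_le_nhds
  have hbound : ∀ (g : ℝ → ℝ), (∀ b c : ℝ, IntervalIntegrable g volume b c) →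
      (∀ᶠ x in 𝓝 a, (κ - h x) ^ (-p) ≤ g x) →
      IntegrableAtFilter (fun a => (κ - h a) ^ (-p)) (𝓝 a) volume := by
    intro g hg hle'
    obtain ⟨l, u, hlu, hsub⟩ := mem_nhds_iff_exists_Ioo_subset.1 hle'
    refine ⟨Ioo l u, Ioo_mem_nhds hlu.1 hlu.2, ?_⟩
    have h1 := ((intervalIntegrable_iff_integrableOn_Ioo_of_le (hlu.1.trans hlu.2).le).1 (hg l u))
    refine Integrable.mono' h1 hmeas.aestronglyMeasurable ?_
    rw [ae_restrict_iff' measurableSet_Ioo]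
    refine Eventually.of_forall fun x hx => ?_
    rw [Real.norm_of_nonneg (Real.rpow_nonneg (sub_nonneg.2 (hle x)) _)]
    exact hsub hx
  rcases (hle a).eq_or_lt with e | hlt
  · obtain ⟨c, hc, hev⟩ := hnd a ha e
    refine hbound (fun x => c ^ (-p) * |x - a| ^ (-(2 * p)))
      (fun b d => (intervalIntegrable_abs_sub_rpow (by linarith) a b d).const_mul _) ?_
    filter_upwards [hev] with x hx
    -- At the contact point the negative power of zero has the default value `0`, so the majorant
    -- holds there too.
    rcases eq_or_ne x a with rfl | hne
    · rw [e, sub_self, Real.zero_rpow (by linarith)]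
      positivity
    · have h1 : 0 < (x - a) ^ 2 := by
        have := sub_ne_zero.2 hne
        positivity
      calc (κ - h x) ^ (-p) ≤ (c * (x - a) ^ 2) ^ (-p) :=
            Real.rpow_le_rpow_of_nonpos (mul_pos hc h1) hx (by linarith)
        _ = c ^ (-p) * |x - a| ^ (-(2 * p)) := by
            rw [Real.mul_rpow hc.le h1.le, ← sq_abs, ← Real.rpow_natCast,
              ← Real.rpow_mul (abs_nonneg _)]
            congr 2
            push_cast
            ring
  · refine hbound (fun _ => (κ - h a) ^ (-p) + 1) (fun b c => by simp) ?_
    have h1 : ContinuousAt (fun x => (κ - h x) ^ (-p)) a :=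
      (by fun_prop : Continuous fun x => κ - h x).continuousAt.rpow_const
        (Or.inl (sub_pos.2 hlt).ne')
    filter_upwards [h1.eventually (Iio_mem_nhds (lt_add_one _))] with x hx using le_of_lt hx

/-- The right side is the convex combination of `1` and `(κ - h a) / κ` with weight `μ κ` on the
latter, and both are at least `(κ - h a) / L`. The bound is uniform in `μ`, hence provides an
integrable majorant. -/
theorem div_le_one_sub_mul {L : ℝ} (hκ : 0 < κ) (hle : ∀ a, h a ≤ κ) (hκL : κ ≤ L)
    (hL : ∀ a, κ - h a ≤ L) {μ : ℝ} (hμ : μ ∈ Icc 0 κ⁻¹) (a : ℝ) :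
    (κ - h a) / L ≤ 1 - μ * h a := by
  have hL0 : 0 < L := hκ.trans_le hκL
  have h1 : μ * κ ≤ 1 := by
    have := mul_le_mul_of_nonneg_right hμ.2 hκ.le
    rwa [inv_mul_cancel₀ hκ.ne'] at this
  have h2 : 0 ≤ κ - h a := sub_nonneg.2 (hle a)
  have h3 : (κ - h a) / L ≤ 1 := (div_le_one hL0).2 (hL a)
  have h4 : (κ - h a) / L ≤ (κ - h a) / κ := div_le_div_of_nonneg_left h2 hκ hκL
  have h5 : 1 - μ * h a = (1 - μ * κ) * 1 + μ * κ * ((κ - h a) / κ) := by field_simp; ring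
  rw [h5]
  have h6 := mul_le_mul_of_nonneg_left h3 (sub_nonneg.2 h1)
  have h7 := mul_le_mul_of_nonneg_left h4 (mul_nonneg hμ.1 hκ.le)
  linarith

theorem exists_length_bound (κ : ℝ) (hh : Continuous h)
    (hper : Function.Periodic h 1) : ∃ L, κ ≤ L ∧ ∀ a, κ - h a ≤ L := by
  obtain ⟨B, hB⟩ := isCompact_Icc.exists_bound_of_continuousOn
    (hh.continuousOn (s := Icc (0 : ℝ) 1))
  refine ⟨max κ (κ + B), le_max_left _ _, fun a => ?_⟩
  obtain ⟨y, hy, hay⟩ := hper.exists_mem_Ico₀ one_pos a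
  have h1 := neg_le_of_abs_le (hB y ⟨hy.1, hy.2.le⟩)
  rw [hay]
  exact le_trans (by linarith) (le_max_right _ _)

/-- The exponent is split: the part `s` is estimated by the worst value `1 - μ κ`, the part `p` by
the fixed integrable function `(κ - h)^(-p)`. -/
theorem powMean_upper {s p L : ℝ} (hs : 0 ≤ s) (hp : 0 < p) (hh : Continuous h) (hκ : 0 < κ)
    (hle : ∀ a, h a ≤ κ) (hκL : κ ≤ L) (hL : ∀ a, κ - h a ≤ L)
    (hfin : {a | a ∈ Icc (0 : ℝ) 1 ∧ h a = κ}.Finite)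
    (hint : IntervalIntegrable (fun a => (κ - h a) ^ (-p)) volume 0 1)
    {μ : ℝ} (hμ : μ ∈ Ico 0 κ⁻¹) :
    powMean (-(s + p)) h μ ≤
      L ^ p * (∫ a in (0 : ℝ)..1, (κ - h a) ^ (-p)) * (1 - μ * κ) ^ (-s) := by
  have hL0 : 0 < L := hκ.trans_le hκL
  have h1 := mul_lt_one_of_mem hκ hμ.2
  have hJ := one_sub_mul_pos hκ hle hμ
  rw [mul_right_comm, ← intervalIntegral.integral_const_mul]
  refine intervalIntegral.integral_mono_ae_restrict zero_le_one
    ((continuous_one_sub_mul_rpow hh _ hJ).intervalIntegrable _ _) (hint.const_mul _) ?_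
  rw [EventuallyLE, ae_restrict_iff' measurableSet_Icc]
  filter_upwards [ae_lt_of_finite hle hfin] with a ha ha'
  have h2 : 0 < κ - h a := sub_pos.2 (ha ha')
  rw [neg_add, Real.rpow_add (hJ a)]
  have h3 : (1 - μ * h a) ^ (-s) ≤ (1 - μ * κ) ^ (-s) :=
    Real.rpow_le_rpow_of_nonpos h1 (one_sub_mul_le hle hμ.1 a) (by linarith)
  have h4 : (1 - μ * h a) ^ (-p) ≤ L ^ p * (κ - h a) ^ (-p) := by
    refine (Real.rpow_le_rpow_of_nonpos (div_pos h2 hL0)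
      (div_le_one_sub_mul hκ hle hκL hL ⟨hμ.1, hμ.2.le⟩ a) (by linarith)).trans (le_of_eq ?_)
    rw [Real.div_rpow h2.le hL0.le, Real.rpow_neg hL0.le, div_inv_eq_mul, mul_comm]
  calc _ ≤ (1 - μ * κ) ^ (-s) * (L ^ p * (κ - h a) ^ (-p)) :=
        mul_le_mul h3 h4 (Real.rpow_nonneg (hJ a).le _) (Real.rpow_nonneg h1.le _)
    _ = _ := by ring

theorem integral_one_sub_mul_rpow_le {q : ℝ} (hq : q < 1) (hκ : 0 < κ) {η : ℝ}
    (hη : η ∈ Ico 0 κ⁻¹) :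
    ∫ μ in (0 : ℝ)..η, (1 - μ * κ) ^ (-q) ≤ (κ * (1 - q))⁻¹ := by
  have hlt : ∀ μ ∈ Icc 0 η, 0 < 1 - μ * κ := fun μ hμ =>
    mul_lt_one_of_mem hκ (hμ.2.trans_lt hη.2)
  have hq' : 0 < 1 - q := by linarith
  have := intervalIntegral.integral_eq_sub_of_hasDerivAt (a := 0) (b := η)
    (f := fun μ => -((κ * (1 - q))⁻¹ * (1 - μ * κ) ^ (1 - q)))
    (f' := fun μ => (1 - μ * κ) ^ (-q))
    (fun μ hμ => by
      rw [uIcc_of_le hη.1] at hμ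
      have h1 := hlt μ hμ
      have h2 : HasDerivAt (fun μ => 1 - μ * κ) (-κ) μ := by
        simpa using ((hasDerivAt_id μ).mul_const κ).const_sub 1
      refine ((h2.rpow_const (p := 1 - q) (Or.inl h1.ne')).const_mul
        (κ * (1 - q))⁻¹).neg.congr_deriv ?_
      rw [show 1 - q - 1 = -q by ring]
      field_simp)
    (ContinuousOn.intervalIntegrable (by
      rw [uIcc_of_le hη.1]
      exact ContinuousOn.rpow_const (by fun_prop) fun μ hμ => Or.inl (hlt μ hμ).ne'))
  rw [this]
  have h3 : 0 ≤ (κ * (1 - q))⁻¹ * (1 - η * κ) ^ (1 - q) :=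
    mul_nonneg (inv_nonneg.2 (mul_pos hκ hq').le) (Real.rpow_nonneg (hlt η ⟨hη.1, le_rfl⟩).le _)
  simp only [zero_mul, sub_zero, Real.one_rpow, mul_one]
  linarith

/-- For `lam > 1` and nondegenerate contacts the time integral stays bounded. -/
theorem exists_time_bound_of_one_lt {lam : ℝ} (hl : 1 < lam) (hh : Continuous h)
    (hper : Function.Periodic h 1) (hκ : 0 < κ) (hle : ∀ a, h a ≤ κ)
    (hfin : {a | a ∈ Icc (0 : ℝ) 1 ∧ h a = κ}.Finite)
    (hnd : ∀ a ∈ Icc (0 : ℝ) 1, h a = κ → ∃ c > 0, ∀ᶠ x in 𝓝 a, c * (x - a) ^ 2 ≤ κ - h x) :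
    ∃ B, ∀ η ∈ Ico 0 κ⁻¹, ∫ μ in (0 : ℝ)..η, powMean (-1 / lam) h μ ^ (2 * lam) ≤ B := by
  have hl0 : 0 < lam := by linarith
  -- The lower bound on `s` makes `p = 1 / lam - s` less than `1 / 2`, so the contact singularity is
  -- integrable; the upper bound gives `2 * lam * s < 1`, so the time integral converges. The two
  -- are compatible because `lam > 1`.
  obtain ⟨s, hs1, hs2⟩ : ∃ s, max 0 (1 / lam - 1 / 2) < s ∧ s < 1 / (2 * lam) := by
    refine exists_between (max_lt (by positivity) ?_)
    have : 1 / lam - 1 / 2 - 1 / (2 * lam) = (1 - lam) / (2 * lam) := by field_simp; ring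
    have h2 : (1 - lam) / (2 * lam) < 0 := div_neg_of_neg_of_pos (by linarith) (by linarith)
    linarith
  have hs0 : 0 < s := (le_max_left _ _).trans_lt hs1
  have hs3 : 1 / lam - 1 / 2 < s := (le_max_right _ _).trans_lt hs1
  have hp0 : 0 < 1 / lam - s := by
    have : 1 / (2 * lam) = 1 / lam / 2 := by field_simp
    have h2 : 0 < 1 / lam := by positivity
    linarith
  have hint := intervalIntegrable_contact hp0 (by linarith) hh hle hnd
  obtain ⟨L, hκL, hL⟩ := exists_length_bound κ hh hper
  set A := L ^ (1 / lam - s) * ∫ a in (0 : ℝ)..1, (κ - h a) ^ (-(1 / lam - s)) with hA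
  have hA0 : 0 ≤ A := mul_nonneg (Real.rpow_nonneg (hκ.le.trans hκL) _)
    (intervalIntegral.integral_nonneg zero_le_one fun a _ =>
      Real.rpow_nonneg (sub_nonneg.2 (hle a)) _)
  have hq1 : 2 * lam * s < 1 := by
    have := mul_lt_mul_of_pos_left hs2 (show 0 < 2 * lam by linarith)
    rwa [mul_one_div_cancel (by positivity)] at this
  refine ⟨A ^ (2 * lam) * (κ * (1 - 2 * lam * s))⁻¹, fun η hη => ?_⟩
  have hlt : ∀ μ ∈ Icc 0 η, 0 < 1 - μ * κ := fun μ hμ =>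
    mul_lt_one_of_mem hκ (hμ.2.trans_lt hη.2)
  calc _ ≤ ∫ μ in (0 : ℝ)..η, A ^ (2 * lam) * (1 - μ * κ) ^ (-(2 * lam * s)) := by
        refine intervalIntegral.integral_mono_on hη.1 ?_ ?_ ?_
        · refine ContinuousOn.intervalIntegrable ?_
          rw [uIcc_of_le hη.1]
          exact (continuousOn_powMean_rpow hh hκ hle).mono fun μ hμ => ⟨hμ.1, hμ.2.trans_lt hη.2⟩
        · refine ContinuousOn.intervalIntegrable ?_
          rw [uIcc_of_le hη.1]
          exact continuousOn_const.mul
            (ContinuousOn.rpow_const (by fun_prop) fun μ hμ => Or.inl (hlt μ hμ).ne')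
        · intro μ hμ
          have hμ' : μ ∈ Ico 0 κ⁻¹ := ⟨hμ.1, hμ.2.trans_lt hη.2⟩
          have h1 := powMean_upper hs0.le hp0 hh hκ hle hκL hL hfin hint hμ'
          have e1 : -(s + (1 / lam - s)) = -1 / lam := by ring
          rw [e1, ← hA] at h1
          have h2 := Real.rpow_le_rpow (powMean_pos _ hh (one_sub_mul_pos hκ hle hμ')).le h1
            (show 0 ≤ 2 * lam by linarith)
          rw [Real.mul_rpow hA0 (Real.rpow_nonneg (hlt μ hμ).le _),
            ← Real.rpow_mul (hlt μ hμ).le] at h2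
          rwa [show -s * (2 * lam) = -(2 * lam * s) by ring] at h2
    _ ≤ _ := by
        rw [intervalIntegral.integral_const_mul]
        exact mul_le_mul_of_nonneg_left (integral_one_sub_mul_rpow_le hq1 hκ hη)
          (Real.rpow_nonneg hA0 _)

/-- Convergence is dominated by a multiple of `(κ - h)^(-p)`. Positivity of the limit comes from an
upper bound on the base that is uniform in `μ`. -/
theorem tendsto_powMean_of_contact {p : ℝ} (hp0 : 0 < p) (hp : p < 1 / 2) (hh : Continuous h)
    (hper : Function.Periodic h 1) (hκ : 0 < κ) (hle : ∀ a, h a ≤ κ)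
    (hfin : {a | a ∈ Icc (0 : ℝ) 1 ∧ h a = κ}.Finite)
    (hnd : ∀ a ∈ Icc (0 : ℝ) 1, h a = κ → ∃ c > 0, ∀ᶠ x in 𝓝 a, c * (x - a) ^ 2 ≤ κ - h x) :
    Tendsto (powMean (-p) h) (𝓝[<] κ⁻¹) (𝓝 (powMean (-p) h κ⁻¹)) ∧ 0 < powMean (-p) h κ⁻¹ := by
  have hint := intervalIntegrable_contact hp0 hp hh hle hnd
  obtain ⟨L, hκL, hL⟩ := exists_length_bound κ hh hper
  have hL0 : 0 < L := hκ.trans_le hκL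
  have hlim : Tendsto (powMean (-p) h) (𝓝[<] κ⁻¹) (𝓝 (powMean (-p) h κ⁻¹)) := by
    apply intervalIntegral.tendsto_integral_filter_of_dominated_convergence
      (fun a => L ^ p * (κ - h a) ^ (-p))
    · filter_upwards [eventually_mem_Ico hκ] with μ hμ
      exact (continuous_one_sub_mul_rpow hh _ (one_sub_mul_pos hκ hle hμ)).aestronglyMeasurable
    · filter_upwards [eventually_mem_Ico hκ] with μ hμ
      filter_upwards [ae_lt_of_finite hle hfin] with a ha ha'
      rw [uIoc_of_le zero_le_one] at ha'
      have h2 : 0 < κ - h a := sub_pos.2 (ha ⟨ha'.1.le, ha'.2⟩)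
      rw [Real.norm_of_nonneg (Real.rpow_nonneg (one_sub_mul_pos hκ hle hμ a).le _)]
      refine (Real.rpow_le_rpow_of_nonpos (div_pos h2 hL0)
        (div_le_one_sub_mul hκ hle hκL hL ⟨hμ.1, hμ.2.le⟩ a) (by linarith)).trans (le_of_eq ?_)
      rw [Real.div_rpow h2.le hL0.le, Real.rpow_neg hL0.le, div_inv_eq_mul, mul_comm]
    · exact hint.const_mul _
    · filter_upwards [ae_lt_of_finite hle hfin] with a ha ha'
      rw [uIoc_of_le zero_le_one] at ha'
      have h2 : 0 < κ - h a := sub_pos.2 (ha ⟨ha'.1.le, ha'.2⟩)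
      have h3 : 0 < 1 - κ⁻¹ * h a := (div_pos h2 hL0).trans_le
        (div_le_one_sub_mul hκ hle hκL hL ⟨(inv_pos.2 hκ).le, le_rfl⟩ a)
      have h4 : ContinuousAt (fun μ => (1 - μ * h a) ^ (-p)) κ⁻¹ :=
        (by fun_prop : Continuous fun μ => 1 - μ * h a).continuousAt.rpow_const (Or.inl h3.ne')
      exact h4.tendsto.mono_left nhdsWithin_le_nhds
  refine ⟨hlim, ?_⟩
  have hub : ∀ μ ∈ Ico 0 κ⁻¹, ∀ a, 1 - μ * h a ≤ 1 + κ⁻¹ * L := by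
    intro μ hμ a
    have h1 : -h a ≤ L := by linarith [hL a]
    have h2 := mul_le_mul_of_nonneg_left h1 hμ.1
    have h3 := mul_le_mul_of_nonneg_right hμ.2.le hL0.le
    linarith
  have hpos : 0 < (1 + κ⁻¹ * L) ^ (-p) := by positivity
  refine hpos.trans_le (ge_of_tendsto hlim ?_)
  filter_upwards [eventually_mem_Ico hκ] with μ hμ
  have h1 : ∫ _ in (0 : ℝ)..1, (1 + κ⁻¹ * L) ^ (-p) ≤ powMean (-p) h μ :=
    intervalIntegral.integral_mono_on zero_le_one (by simp)
      ((continuous_one_sub_mul_rpow hh _ (one_sub_mul_pos hκ hle hμ)).intervalIntegrable _ _)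
      fun a _ => Real.rpow_le_rpow_of_nonpos (one_sub_mul_pos hκ hle hμ a) (hub μ hμ a)
        (by linarith)
  simpa using h1

/-- At `μ = κ⁻¹` the base may vanish, so positivity rests on a point where `h = 0`, at which the
integrand is `1`. -/
theorem powMean_pos_of_nonneg {r : ℝ} (hr : 0 ≤ r) (hh : Continuous h) (hκ : 0 < κ)
    (hle : ∀ a, h a ≤ κ) (hzero : ∃ a ∈ Icc (0 : ℝ) 1, h a = 0) {μ : ℝ} (hμ : μ ∈ Icc 0 κ⁻¹) :
    0 < powMean r h μ := by
  have hJ : ∀ a, 0 ≤ 1 - μ * h a := by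
    intro a
    have h1 : μ * κ ≤ 1 := by
      have := mul_le_mul_of_nonneg_right hμ.2 hκ.le
      rwa [inv_mul_cancel₀ hκ.ne'] at this
    linarith [one_sub_mul_le hle hμ.1 a]
  obtain ⟨a0, ha0, h0⟩ := hzero
  refine intervalIntegral.integral_pos one_pos ?_ (fun a _ => Real.rpow_nonneg (hJ a) r)
    ⟨a0, ha0, by simp [h0]⟩
  exact ((by fun_prop : Continuous fun a => 1 - μ * h a).rpow_const
    fun a => Or.inr hr).continuousOn

/-- The integrand is continuous up to and including `κ⁻¹`, and the full integral serves as the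
bound. No sign of `q` is needed since the mean stays positive. -/
theorem exists_time_bound_of_nonneg {r q : ℝ} (hr : 0 ≤ r) (hh : Continuous h) (hκ : 0 < κ)
    (hle : ∀ a, h a ≤ κ) (hzero : ∃ a ∈ Icc (0 : ℝ) 1, h a = 0) :
    ∃ B, ∀ η ∈ Ico 0 κ⁻¹, ∫ μ in (0 : ℝ)..η, powMean r h μ ^ q ≤ B := by
  have hi := inv_pos.2 hκ
  have hcont : ContinuousOn (fun μ => powMean r h μ ^ q) (Icc 0 κ⁻¹) :=
    (continuousOn_powMean r hh fun _ _ _ => Or.inr hr).rpow_const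
      fun _ hμ => Or.inl (powMean_pos_of_nonneg hr hh hκ hle hzero hμ).ne'
  refine ⟨∫ μ in (0 : ℝ)..κ⁻¹, powMean r h μ ^ q, fun η hη => ?_⟩
  refine intervalIntegral.integral_mono_interval le_rfl hη.1 hη.2.le ?_ ?_
  · rw [EventuallyLE, ae_restrict_iff' measurableSet_Ioc]
    exact Eventually.of_forall fun μ hμ => Real.rpow_nonneg
      (powMean_pos_of_nonneg hr hh hκ hle hzero ⟨hμ.1.le, hμ.2⟩).le _
  · refine ContinuousOn.intervalIntegrable ?_
    rwa [uIcc_of_le hi.le]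

end Upper

/-! ### Order of contact at the extremal points -/

section Contact

variable {h : ℝ → ℝ} {κ : ℝ}

theorem deriv_eq_zero_of_max (hle : ∀ a, h a ≤ κ) {a : ℝ} (ha : h a = κ) : deriv h a = 0 :=
  IsLocalMax.deriv_eq_zero (Eventually.of_forall fun x => (hle x).trans ha.ge)

/-- The maximum is global on the line, so `h'` vanishes at `a` even if `a` is an endpoint of
`[0,1]`; the mean value inequality, applied twice with a bound on `h''`, gives the estimate. -/
theorem exists_quadratic_upper (hh : ContDiff ℝ ∞ h) (hle : ∀ a, h a ≤ κ) {a : ℝ}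
    (ha01 : a ∈ Icc (0 : ℝ) 1) (ha : h a = κ) :
    ∃ C, 0 ≤ C ∧ ∀ x ∈ Icc (0 : ℝ) 1, κ - h x ≤ C * (x - a) ^ 2 := by
  have h1 : ContDiff ℝ ∞ (deriv h) := (contDiff_infty_iff_deriv.1 hh).2
  have h2 : Continuous (deriv (deriv h)) := h1.continuous_deriv (by simp)
  obtain ⟨M, hM⟩ := isCompact_Icc.exists_bound_of_continuousOn
    (h2.continuousOn (s := Icc (0 : ℝ) 1))
  have hM0 : 0 ≤ M := (norm_nonneg _).trans (hM a ha01)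
  have hd : Differentiable ℝ h := hh.differentiable (by simp)
  have hd1 : Differentiable ℝ (deriv h) := h1.differentiable (by simp)
  refine ⟨M, hM0, fun x hx => ?_⟩
  have hsub : uIcc a x ⊆ Icc 0 1 := uIcc_subset_Icc ha01 hx
  have hb : ∀ y ∈ uIcc a x, ‖deriv h y‖ ≤ M * |x - a| := by
    intro y hy
    have h3 := (convex_Icc (0 : ℝ) 1).norm_image_sub_le_of_norm_deriv_le
      (fun z _ => hd1 z) hM ha01 (hsub hy)
    rw [deriv_eq_zero_of_max hle ha, sub_zero] at h3
    refine h3.trans (mul_le_mul_of_nonneg_left ?_ hM0)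
    rw [Real.norm_eq_abs]
    exact abs_sub_left_of_mem_uIcc hy
  have h4 := (convex_uIcc a x).norm_image_sub_le_of_norm_deriv_le
    (fun z _ => hd z) hb left_mem_uIcc right_mem_uIcc
  rw [ha, Real.norm_eq_abs, Real.norm_eq_abs, mul_assoc, ← sq, sq_abs] at h4
  have := neg_le_of_abs_le h4
  linarith

/-- Second-order Taylor expansion with remainder at most half of the quadratic term. Working with
absolute values avoids determining the sign of `h'' a`. -/
theorem exists_quadratic_lower (hh : ContDiff ℝ ∞ h) (hle : ∀ a, h a ≤ κ) {a : ℝ}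
    (ha : h a = κ) (hne : deriv (deriv h) a ≠ 0) :
    ∃ c > 0, ∀ᶠ x in 𝓝 a, c * (x - a) ^ 2 ≤ κ - h x := by
  set b := deriv (deriv h) a with hb
  have hb0 : 0 < |b| := abs_pos.2 hne
  have h1 := taylor_isLittleO_univ (n := 2) (x₀ := a) (contDiff_infty.1 hh 2)
  have h2 : ∀ x, taylorWithinEval h 2 univ a x = κ + b / 2 * (x - a) ^ 2 := by
    intro x
    rw [taylorWithinEval_succ, taylorWithinEval_succ, taylor_within_zero_eval]
    simp only [iteratedDerivWithin_univ, iteratedDeriv_succ, iteratedDeriv_zero, zero_add,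
      deriv_eq_zero_of_max hle ha, ha, ← hb, smul_eq_mul]
    norm_num
    ring
  refine ⟨|b| / 4, by positivity, ?_⟩
  filter_upwards [h1.def (show 0 < |b| / 4 by positivity)] with x hx
  rw [h2, Real.norm_eq_abs, Real.norm_eq_abs, abs_of_nonneg (sq_nonneg (x - a))] at hx
  have h3 : |κ - h x| = κ - h x := abs_of_nonneg (sub_nonneg.2 (hle x))
  have h4 : |b / 2 * (x - a) ^ 2| = |b| / 2 * (x - a) ^ 2 := by
    rw [abs_mul, abs_div, abs_of_nonneg (sq_nonneg (x - a)), abs_two]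
  have h5 : |b / 2 * (x - a) ^ 2| ≤ |h x - (κ + b / 2 * (x - a) ^ 2)| + |κ - h x| := by
    rw [← abs_neg (b / 2 * (x - a) ^ 2)]
    refine le_trans (le_of_eq ?_) (abs_add_le _ _)
    congr 1
    ring
  rw [h3, h4] at h5
  linarith

/-- If `κ` were zero, `h ≤ 0` with mean zero would vanish throughout `[0,1]`, and the contact set
would be infinite. -/
theorem pos_of_finite_max (hh : Continuous h) (hle : ∀ a, h a ≤ κ)
    (hint : ∫ a in (0 : ℝ)..1, h a = 0) (hzero : ∃ a ∈ Icc (0 : ℝ) 1, h a = 0)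
    (hfin : {a | a ∈ Icc (0 : ℝ) 1 ∧ h a = κ}.Finite) : 0 < κ := by
  obtain ⟨a0, ha0, h0⟩ := hzero
  refine lt_of_le_of_ne (h0 ▸ hle a0) fun hκ => ?_
  have hall : ∀ a ∈ Icc (0 : ℝ) 1, h a = κ := by
    intro a ha
    by_contra hne
    have hlt : h a < 0 := hκ ▸ lt_of_le_of_ne (hle a) hne
    have := intervalIntegral.integral_pos one_pos (f := fun x => -h x) hh.neg.continuousOn
      (fun x _ => by linarith [hle x]) ⟨a, ha, by linarith⟩
    rw [intervalIntegral.integral_neg, hint] at this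
    linarith
  exact (Icc_infinite (zero_lt_one (α := ℝ))) (hfin.subset fun a ha => ⟨ha, hall a ha⟩)

end Contact

/-! ### A common peak for both signs of the parameter -/

section Extremum

variable {lam : ℝ} {u0 : ℝ → ℝ}

/-- The greatest value of `lam * u₀'`. -/
noncomputable def peak (lam : ℝ) (u0 : ℝ → ℝ) : ℝ :=
  if 0 < lam then lam * maxSlope u0 else lam * minSlope u0

theorem etaStar_eq (lam : ℝ) (u0 : ℝ → ℝ) : etaStar lam u0 = (peak lam u0)⁻¹ := by
  unfold etaStar peak
  split_ifs <;> rw [one_div]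

theorem mem_maxPoints_iff (hl : 0 < lam) (a : ℝ) :
    a ∈ maxPoints u0 ↔ a ∈ Icc (0 : ℝ) 1 ∧ lam * deriv u0 a = peak lam u0 := by
  simp [maxPoints, peak, hl, hl.ne']

theorem mem_minPoints_iff (hl : lam < 0) (a : ℝ) :
    a ∈ minPoints u0 ↔ a ∈ Icc (0 : ℝ) 1 ∧ lam * deriv u0 a = peak lam u0 := by
  simp [minPoints, peak, hl.not_gt, hl.ne]

theorem deriv_periodic (hper : ∀ x, u0 (x + 1) = u0 x) : Function.Periodic (deriv u0) 1 := by
  intro x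
  have h2 := deriv_comp_add_const u0 1 x
  rw [funext hper] at h2
  exact h2.symm

theorem le_peak (lam : ℝ) (hg : Continuous (deriv u0)) (hper : ∀ x, u0 (x + 1) = u0 x)
    (a : ℝ) : lam * deriv u0 a ≤ peak lam u0 := by
  have hcpt : IsCompact (deriv u0 '' Icc 0 1) := isCompact_Icc.image hg
  obtain ⟨y, hy, hay⟩ := (deriv_periodic hper).exists_mem_Ico₀ one_pos a
  have hmem : deriv u0 y ∈ deriv u0 '' Icc 0 1 := mem_image_of_mem _ ⟨hy.1, hy.2.le⟩
  rw [hay]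
  unfold peak
  split_ifs with hl
  · exact mul_le_mul_of_nonneg_left (le_csSup hcpt.bddAbove hmem) hl.le
  · exact mul_le_mul_of_nonpos_left (csInf_le hcpt.bddBelow hmem) (not_lt.1 hl)

theorem exists_eq_peak (lam : ℝ) (hg : Continuous (deriv u0)) :
    ∃ a ∈ Icc (0 : ℝ) 1, lam * deriv u0 a = peak lam u0 := by
  have hcpt : IsCompact (deriv u0 '' Icc 0 1) := isCompact_Icc.image hg
  have hne : (deriv u0 '' Icc 0 1).Nonempty := (nonempty_Icc.2 zero_le_one).image _
  unfold peak
  split_ifs with hl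
  · obtain ⟨a, ha, h1⟩ := hcpt.sSup_mem hne
    exact ⟨a, ha, by rw [h1, maxSlope]⟩
  · obtain ⟨a, ha, h1⟩ := hcpt.sInf_mem hne
    exact ⟨a, ha, by rw [h1, minSlope]⟩

end Extremum

/-! ### The change of time and passage to the limit -/

section Time

variable {lam : ℝ} {u0 : ℝ → ℝ} {κ : ℝ}

theorem timeOfEta_lt (hg : Continuous (deriv u0)) (hκ : 0 < κ)
    (hle : ∀ a, lam * deriv u0 a ≤ κ) {η1 η2 : ℝ} (h1 : 0 ≤ η1) (h12 : η1 < η2) (h2 : η2 < κ⁻¹) :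
    timeOfEta lam u0 η1 < timeOfEta lam u0 η2 := by
  have hh : Continuous fun a => lam * deriv u0 a := by fun_prop
  have hJ : ∀ μ ∈ Icc 0 η2, ∀ a, 0 < 1 - μ * (lam * deriv u0 a) := fun μ hμ a =>
    one_sub_mul_pos hκ hle ⟨hμ.1, hμ.2.trans_lt h2⟩ a
  rw [timeOfEta_eq lam u0 h1 fun μ hμ => hJ μ ⟨hμ.1, hμ.2.trans h12.le⟩,
    timeOfEta_eq lam u0 (h1.trans h12.le) hJ, ← sub_pos]
  have hint : ∀ b c, 0 ≤ b → b ≤ c → c ≤ η2 → IntervalIntegrable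
      (fun μ => powMean (-1 / lam) (fun a => lam * deriv u0 a) μ ^ (2 * lam)) volume b c := by
    intro b c hb hbc hc
    refine ContinuousOn.intervalIntegrable ?_
    rw [uIcc_of_le hbc]
    exact (continuousOn_powMean_rpow hh hκ hle).mono fun μ hμ =>
      ⟨hb.trans hμ.1, (hμ.2.trans hc).trans_lt h2⟩
  rw [intervalIntegral.integral_interval_sub_left (hint 0 η2 le_rfl (h1.trans h12.le) le_rfl)
    (hint 0 η1 le_rfl h1 h12.le)]
  exact intervalIntegral.intervalIntegral_pos_of_pos_on (hint η1 η2 h1 h12.le le_rfl)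
    (fun μ hμ => Real.rpow_pos_of_pos
      (powMean_pos _ hh (hJ μ ⟨h1.trans hμ.1.le, hμ.2.le⟩)) _) h12

theorem timeOfEta_lt_tStar (hg : Continuous (deriv u0)) (hκ : 0 < κ)
    (hle : ∀ a, lam * deriv u0 a ≤ κ) (hη : etaStar lam u0 = κ⁻¹) {η : ℝ} (h : η ∈ Ico 0 κ⁻¹) :
    (timeOfEta lam u0 η : EReal) < tStar lam u0 := by
  obtain ⟨η2, h1, h2⟩ := exists_between h.2
  refine (EReal.coe_lt_coe_iff.2 (timeOfEta_lt hg hκ hle h.1 h1 h2)).trans_le ?_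
  unfold tStar
  rw [hη]
  exact le_iSup₂_of_le η2 ⟨h.1.trans h1.le, h2⟩ le_rfl

theorem tStar_eq_top (hκ : 0 < κ) (hη : etaStar lam u0 = κ⁻¹)
    (ht : Tendsto (timeOfEta lam u0) (𝓝[<] κ⁻¹) atTop) : tStar lam u0 = ⊤ := by
  refine EReal.eq_top_iff_forall_lt _ |>.2 fun y => ?_
  obtain ⟨η, h1, h2⟩ := ((ht.eventually_gt_atTop y).and (eventually_mem_Ico hκ)).exists
  refine (EReal.coe_lt_coe_iff.2 h1).trans_le ?_
  unfold tStar
  rw [hη]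
  exact le_iSup₂_of_le η h2 le_rfl

theorem tStar_ne_top (hη : etaStar lam u0 = κ⁻¹) {B : ℝ}
    (hB : ∀ η ∈ Ico 0 κ⁻¹, timeOfEta lam u0 η ≤ B) : tStar lam u0 ≠ ⊤ := by
  refine ne_top_of_le_ne_top (EReal.coe_ne_top B) ?_
  unfold tStar
  rw [hη]
  exact iSup₂_le fun η h => EReal.coe_le_coe_iff.2 (hB η h)

theorem eventually_upTo {T : EReal} {c : ℝ} (hc : (c : EReal) < T) :
    ∀ᶠ t : ℝ in upTo T, c < t ∧ (t : EReal) < T := by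
  have := preimage_mem_comap (m := fun t : ℝ => (t : EReal)) (Ioo_mem_nhdsLT hc)
  filter_upwards [this] with t ht
  exact ⟨EReal.coe_lt_coe_iff.1 ht.1, ht.2⟩

/-- The limit of the jacobian is the limit of its explicit representation. -/
theorem tendsto_jacobian (hlam : lam ≠ 0) (hsm : ContDiff ℝ ∞ u0)
    (hper : ∀ x, u0 (x + 1) = u0 x) (hκ : 0 < κ) (hle : ∀ a, lam * deriv u0 a ≤ κ)
    (hmax : ∃ a, lam * deriv u0 a = κ) (hη : etaStar lam u0 = κ⁻¹) {u γ : ℝ → ℝ → ℝ}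
    (hu : IsSolution lam u0 (tStar lam u0) u) (hγ : IsCharacteristics (tStar lam u0) u γ) {a : ℝ}
    {F : Filter ℝ}
    (hF : Tendsto (fun μ => (1 - μ * (lam * deriv u0 a)) ^ (-1 / lam) /
      powMean (-1 / lam) (fun a => lam * deriv u0 a) μ) (𝓝[<] κ⁻¹) F) :
    Tendsto (fun t => jacobian γ a t) (upTo (tStar lam u0)) F := by
  have hg : Continuous (deriv u0) := hsm.continuous_deriv (by simp)
  have key := fun (t : ℝ) (ht : 0 ≤ t) (htT : (t : EReal) < tStar lam u0) =>
    exists_eta hlam hsm hper hu hγ ht htT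
  -- The new time is chosen separately for each `t`; its limit follows from monotonicity of
  -- `timeOfEta` alone.
  choose! e he0 heJ het hed using key
  obtain ⟨am, ham⟩ := hmax
  have helt : ∀ t : ℝ, 0 ≤ t → (t : EReal) < tStar lam u0 → e t < κ⁻¹ := by
    intro t ht htT
    have h1 := heJ t ht htT am
    rw [ham] at h1
    rw [← one_div, lt_div_iff₀ hκ]
    linarith
  have hi := inv_pos.2 hκ
  have hev0 : ∀ᶠ t : ℝ in upTo (tStar lam u0), 0 < t ∧ (t : EReal) < tStar lam u0 := by
    have h1 := timeOfEta_lt_tStar hg hκ hle hη ⟨le_rfl, hi⟩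
    have h2 : timeOfEta lam u0 0 = 0 := by simp [timeOfEta]
    rw [h2] at h1
    exact eventually_upTo h1
  have hlim : Tendsto e (upTo (tStar lam u0)) (𝓝[<] κ⁻¹) := by
    rw [tendsto_nhdsWithin_iff]
    refine ⟨?_, hev0.mono fun t ht => helt t ht.1.le ht.2⟩
    rw [tendsto_order]
    refine ⟨fun b hb => ?_, fun b hb => hev0.mono fun t ht => (helt t ht.1.le ht.2).trans hb⟩
    -- Once `t` exceeds `timeOfEta (max b 0)`, which lies below `t_*`, the new time `e t` must
    -- exceed `b`.
    have hb' : max b 0 ∈ Ico 0 κ⁻¹ := ⟨le_max_right _ _, max_lt hb hi⟩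
    filter_upwards [hev0, eventually_upTo (timeOfEta_lt_tStar hg hκ hle hη hb')] with t ht ht2
    by_contra hcon
    have h1 : e t ≤ max b 0 := (not_lt.1 hcon).trans (le_max_left _ _)
    have h2 : timeOfEta lam u0 (e t) ≤ timeOfEta lam u0 (max b 0) := by
      rcases h1.eq_or_lt with h3 | h3
      · rw [h3]
      · exact (timeOfEta_lt hg hκ hle (he0 t ht.1.le ht.2) h3 hb'.2).le
    rw [het t ht.1.le ht.2] at h2
    exact absurd ht2.1 (not_lt.2 h2)
  refine (hF.comp hlim).congr' ?_
  filter_upwards [hev0] with t ht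
  exact (hed t ht.1.le ht.2 a).deriv.symm

end Time

/-! ### Assembly of the hypotheses and the dichotomy for the lifespan -/

/-- The facts about `h = lam * u₀'` on which the limits rest. -/
structure SlopeData (lam κ : ℝ) (u0 h : ℝ → ℝ) : Prop where
  eq : h = fun a => lam * deriv u0 a
  smooth : ContDiff ℝ ∞ h
  periodic : Function.Periodic h 1
  pos : 0 < κ
  le : ∀ a, h a ≤ κ
  finite : {a | a ∈ Icc (0 : ℝ) 1 ∧ h a = κ}.Finite
  attained : ∃ a ∈ Icc (0 : ℝ) 1, h a = κ
  zero : ∃ a ∈ Icc (0 : ℝ) 1, h a = 0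
  eta : etaStar lam u0 = κ⁻¹

/-- Multiplication by a negative `lam` turns minima of `u₀'` into maxima of `h`, so one description
covers both signs. -/
theorem slopeData {lam : ℝ} (hlam : lam ≠ 0) {u0 : ℝ → ℝ} (hsm : ContDiff ℝ ∞ u0)
    (hper : ∀ x, u0 (x + 1) = u0 x) (hmax : 0 < lam → (maxPoints u0).Finite)
    (hmin : lam < 0 → (minPoints u0).Finite) :
    SlopeData lam (peak lam u0) u0 (fun a => lam * deriv u0 a) := by
  have hg : ContDiff ℝ ∞ (deriv u0) := (contDiff_infty_iff_deriv.1 hsm).2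
  have h01 : u0 0 = u0 1 := by simpa using (hper 0).symm
  have hfin : {a | a ∈ Icc (0 : ℝ) 1 ∧ lam * deriv u0 a = peak lam u0}.Finite := by
    rcases lt_or_gt_of_ne hlam with hl | hl
    · exact (hmin hl).subset fun a ha => (mem_minPoints_iff hl a).2 ha
    · exact (hmax hl).subset fun a ha => (mem_maxPoints_iff hl a).2 ha
  have hzero : ∃ a ∈ Icc (0 : ℝ) 1, lam * deriv u0 a = 0 := by
    obtain ⟨c, hc, hc0⟩ := exists_deriv_eq_zero (f := u0) zero_lt_one
      hsm.continuous.continuousOn h01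
    exact ⟨c, ⟨hc.1.le, hc.2.le⟩, by rw [hc0, mul_zero]⟩
  have hint : ∫ a in (0 : ℝ)..1, lam * deriv u0 a = 0 := by
    rw [intervalIntegral.integral_const_mul, intervalIntegral.integral_deriv_eq_sub
      (fun x _ => hsm.differentiable (by simp) x) (hg.continuous.intervalIntegrable _ _), h01,
      sub_self, mul_zero]
  have hle := le_peak lam hg.continuous hper
  exact
    { eq := rfl
      smooth := contDiff_const.mul hg
      periodic := fun x => by simp only [deriv_periodic hper x]
      pos := pos_of_finite_max (continuous_const.mul hg.continuous) hle hint hzero hfin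
      le := hle
      finite := hfin
      attained := exists_eq_peak lam hg.continuous
      zero := hzero
      eta := etaStar_eq lam u0 }

section Limits

variable {lam κ : ℝ} {u0 h : ℝ → ℝ}

theorem SlopeData.one_sub_pos (H : SlopeData lam κ u0 h) {a : ℝ} (ha : h a ≠ κ) :
    0 < 1 - κ⁻¹ * h a := by
  have := mul_lt_mul_of_pos_left (lt_of_le_of_ne (H.le a) ha) (inv_pos.2 H.pos)
  rw [inv_mul_cancel₀ H.pos.ne'] at this
  linarith

theorem SlopeData.tendsto_num (H : SlopeData lam κ u0 h) (r : ℝ) {a : ℝ} (ha : h a ≠ κ) :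
    Tendsto (fun μ => (1 - μ * h a) ^ r) (𝓝[<] κ⁻¹) (𝓝 ((1 - κ⁻¹ * h a) ^ r)) := by
  have h1 : ContinuousAt (fun μ => (1 - μ * h a) ^ r) κ⁻¹ :=
    (by fun_prop : Continuous fun μ => 1 - μ * h a).continuousAt.rpow_const
      (Or.inl (H.one_sub_pos ha).ne')
  exact h1.tendsto.mono_left nhdsWithin_le_nhds

theorem SlopeData.timeOfEta_eq (H : SlopeData lam κ u0 h) {η : ℝ} (hη : η ∈ Ico 0 κ⁻¹) :
    timeOfEta lam u0 η = ∫ μ in (0 : ℝ)..η, powMean (-1 / lam) h μ ^ (2 * lam) := by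
  have hJ : ∀ μ ∈ Icc 0 η, ∀ a, 0 < 1 - μ * h a := fun μ hμ a =>
    one_sub_mul_pos H.pos H.le ⟨hμ.1, hμ.2.trans_lt hη.2⟩ a
  obtain rfl := H.eq
  exact ProudmanJohnson.timeOfEta_eq lam u0 hη.1 hJ

theorem SlopeData.tStar_pos (H : SlopeData lam κ u0 h) (hg : Continuous (deriv u0)) :
    0 < tStar lam u0 := by
  have hle : ∀ a, lam * deriv u0 a ≤ κ := by simpa only [H.eq] using H.le
  have h1 := timeOfEta_lt_tStar hg H.pos hle H.eta ⟨le_rfl, inv_pos.2 H.pos⟩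
  have h2 : timeOfEta lam u0 0 = 0 := by simp [timeOfEta]
  rwa [h2] at h1

theorem SlopeData.contact (H : SlopeData lam κ u0 h) (hl : 0 < lam)
    (hquad : ∀ a ∈ maxPoints u0, iteratedDeriv 3 u0 a ≠ 0) (hκ : κ = peak lam u0) :
    ∀ a ∈ Icc (0 : ℝ) 1, h a = κ → ∃ c > 0, ∀ᶠ x in 𝓝 a, c * (x - a) ^ 2 ≤ κ - h x := by
  intro a ha haκ
  refine exists_quadratic_lower H.smooth H.le haκ ?_
  have h1 := hquad a ((mem_maxPoints_iff hl a).2 ⟨ha, by rw [← hκ, ← haκ, H.eq]⟩)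
  have h2 : deriv (deriv h) a = lam * iteratedDeriv 3 u0 a := by
    have e1 : deriv h = fun x => lam * deriv (deriv u0) x := by
      funext x
      rw [H.eq, deriv_const_mul_field]
    rw [e1, deriv_const_mul_field]
    simp only [iteratedDeriv_succ, iteratedDeriv_zero]
  rw [h2]
  exact mul_ne_zero hl.ne' h1

theorem SlopeData.exists_upper (H : SlopeData lam κ u0 h) :
    ∃ a C, 0 ≤ C ∧ a ∈ Icc (0 : ℝ) 1 ∧ ∀ x ∈ Icc (0 : ℝ) 1, κ - h x ≤ C * (x - a) ^ 2 := by
  obtain ⟨a, ha, haκ⟩ := H.attained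
  obtain ⟨C, hC, hq⟩ := exists_quadratic_upper H.smooth H.le ha haκ
  exact ⟨a, C, hC, ha, hq⟩

theorem SlopeData.tStar_eq_top_iff (H : SlopeData lam κ u0 h) (hlam : lam ≠ 0)
    (hquad : 1 < lam → ∀ a ∈ maxPoints u0, iteratedDeriv 3 u0 a ≠ 0) (hκ : κ = peak lam u0) :
    tStar lam u0 = ⊤ ↔ 0 < lam ∧ lam ≤ 1 := by
  have hcont := H.smooth.continuous
  constructor
  · intro htop
    by_contra hcon
    have hB : ∃ B, ∀ η ∈ Ico 0 κ⁻¹, ∫ μ in (0 : ℝ)..η, powMean (-1 / lam) h μ ^ (2 * lam) ≤ B := by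
      rcases lt_or_gt_of_ne hlam with hl | hl
      · exact exists_time_bound_of_nonneg (div_nonneg_of_nonpos (by norm_num) hl.le) hcont H.pos
          H.le H.zero
      · have hl1 : 1 < lam := by
          by_contra h1
          exact hcon ⟨hl, not_lt.1 h1⟩
        exact exists_time_bound_of_one_lt hl1 hcont H.periodic H.pos H.le H.finite
          (H.contact hl (hquad hl1) hκ)
    obtain ⟨B, hB⟩ := hB
    exact tStar_ne_top H.eta (fun η hη => (H.timeOfEta_eq hη).trans_le (hB η hη)) htop
  · rintro ⟨hl, hl1⟩
    obtain ⟨a, C, hC, ha, hq⟩ := H.exists_upper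
    refine tStar_eq_top H.pos H.eta
      ((tendsto_time_atTop hl hl1 hcont H.pos H.le hC ha hq).congr' ?_)
    filter_upwards [eventually_mem_Ico H.pos] with η hη using (H.timeOfEta_eq hη).symm

end Limits

end ProudmanJohnson

/-! ### The main theorem -/

theorem mainTheorem4 (lam : ℝ) (hlam : lam ≠ 0) (u0 : ℝ → ℝ)
    (hsmooth : ContDiff ℝ ∞ u0) (hper : ∀ x, u0 (x + 1) = u0 x)
    (hmax : 0 < lam → (ProudmanJohnson.maxPoints u0).Finite)
    (hquad : 1 < lam → ∀ a ∈ ProudmanJohnson.maxPoints u0, iteratedDeriv 3 u0 a ≠ 0)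
    (hmin : lam < 0 → (ProudmanJohnson.minPoints u0).Finite) :
    0 < ProudmanJohnson.tStar lam u0 ∧
    (ProudmanJohnson.tStar lam u0 = ⊤ ↔ 0 < lam ∧ lam ≤ 1) ∧
    ∃ C : ℝ → ℝ, (∀ a, 0 < C a) ∧
      ∀ u γ : ℝ → ℝ → ℝ,
        ProudmanJohnson.IsSolution lam u0 (ProudmanJohnson.tStar lam u0) u →
        ProudmanJohnson.IsCharacteristics (ProudmanJohnson.tStar lam u0) u γ →
        ∀ a ∈ Icc (0 : ℝ) 1,
          (∀ t : ℝ, 0 ≤ t → (t : EReal) < ProudmanJohnson.tStar lam u0 →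
            DifferentiableAt ℝ (fun b => γ b t) a) ∧
          (0 < lam → a ∈ ProudmanJohnson.maxPoints u0 →
            Tendsto (fun t => ProudmanJohnson.jacobian γ a t)
              (ProudmanJohnson.upTo (ProudmanJohnson.tStar lam u0)) atTop) ∧
          (0 < lam → lam ≤ 2 → a ∉ ProudmanJohnson.maxPoints u0 →
            Tendsto (fun t => ProudmanJohnson.jacobian γ a t)
              (ProudmanJohnson.upTo (ProudmanJohnson.tStar lam u0)) (𝓝 0)) ∧
          (2 < lam → a ∉ ProudmanJohnson.maxPoints u0 →
            Tendsto (fun t => ProudmanJohnson.jacobian γ a t)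
              (ProudmanJohnson.upTo (ProudmanJohnson.tStar lam u0)) (𝓝 (C a))) ∧
          (lam < 0 → a ∈ ProudmanJohnson.minPoints u0 →
            Tendsto (fun t => ProudmanJohnson.jacobian γ a t)
              (ProudmanJohnson.upTo (ProudmanJohnson.tStar lam u0)) (𝓝 0)) ∧
          (lam < 0 → a ∉ ProudmanJohnson.minPoints u0 →
            Tendsto (fun t => ProudmanJohnson.jacobian γ a t)
              (ProudmanJohnson.upTo (ProudmanJohnson.tStar lam u0)) (𝓝 (C a))) := by
  have hg : Continuous (deriv u0) := hsmooth.continuous_deriv (by simp)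
  have H := ProudmanJohnson.slopeData hlam hsmooth hper hmax hmin
  set κ := ProudmanJohnson.peak lam u0 with hκ
  set h : ℝ → ℝ := fun a => lam * deriv u0 a with hh
  have hcont := H.smooth.continuous
  obtain ⟨am, -, ham⟩ := H.attained
  refine ⟨H.tStar_pos hg, H.tStar_eq_top_iff hlam hquad hκ, ?_⟩
  set Q : ℝ → ℝ := fun a =>
    (1 - κ⁻¹ * h a) ^ (-1 / lam) / ProudmanJohnson.powMean (-1 / lam) h κ⁻¹ with hQ
  -- The constants are fixed before `u` and `γ` are introduced. The default `1` only secures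
  -- positivity where no limit `C` is claimed; elsewhere `Q a` is positive.
  refine ⟨fun a => if 0 < Q a then Q a else 1, fun a => ?_, fun u γ hu hγ a ha => ?_⟩
  · dsimp only
    split_ifs with hpos
    exacts [hpos, one_pos]
  have lim : ∀ {F : Filter ℝ}, Tendsto (fun μ => (1 - μ * h a) ^ (-1 / lam) /
      ProudmanJohnson.powMean (-1 / lam) h μ) (𝓝[<] κ⁻¹) F →
      Tendsto (fun t => ProudmanJohnson.jacobian γ a t)
        (ProudmanJohnson.upTo (ProudmanJohnson.tStar lam u0)) F := fun hF =>
    ProudmanJohnson.tendsto_jacobian hlam hsmooth hper H.pos H.le ⟨am, ham⟩ H.eta hu hγ hF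
  have limC : h a ≠ κ → 0 < ProudmanJohnson.powMean (-1 / lam) h κ⁻¹ →
      Tendsto (ProudmanJohnson.powMean (-1 / lam) h) (𝓝[<] κ⁻¹)
        (𝓝 (ProudmanJohnson.powMean (-1 / lam) h κ⁻¹)) →
      Tendsto (fun t => ProudmanJohnson.jacobian γ a t)
        (ProudmanJohnson.upTo (ProudmanJohnson.tStar lam u0))
        (𝓝 (if 0 < Q a then Q a else 1)) := by
    intro hne hpos hlim
    have hQpos : 0 < Q a := div_pos (Real.rpow_pos_of_pos (H.one_sub_pos hne) _) hpos
    rw [if_pos hQpos]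
    exact lim ((H.tendsto_num _ hne).div hlim hpos.ne')
  have hnegLim : lam < 0 → 0 ≤ -1 / lam ∧ 0 < ProudmanJohnson.powMean (-1 / lam) h κ⁻¹ ∧
      Tendsto (ProudmanJohnson.powMean (-1 / lam) h) (𝓝[<] κ⁻¹)
        (𝓝 (ProudmanJohnson.powMean (-1 / lam) h κ⁻¹)) := by
    intro hl
    have hr : 0 ≤ -1 / lam := div_nonneg_of_nonpos (by norm_num) hl.le
    have hmem : κ⁻¹ ∈ Icc 0 κ⁻¹ := ⟨(inv_pos.2 H.pos).le, le_rfl⟩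
    refine ⟨hr, ProudmanJohnson.powMean_pos_of_nonneg hr hcont H.pos H.le H.zero hmem, ?_⟩
    exact (ProudmanJohnson.continuousOn_powMean (S := univ) _ hcont
      fun _ _ _ => Or.inr hr).continuousAt univ_mem |>.tendsto.mono_left nhdsWithin_le_nhds
  refine ⟨fun t ht htT => ?_, fun hl hmem => ?_, fun hl hl2 hmem => ?_, fun hl hmem => ?_,
    fun hl hmem => ?_, fun hl hmem => ?_⟩
  · obtain ⟨e, -, -, -, hd⟩ := ProudmanJohnson.exists_eta hlam hsmooth hper hu hγ ht htT
    exact (hd a).differentiableAt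
  · have haκ : h a = κ := ((ProudmanJohnson.mem_maxPoints_iff hl a).1 hmem).2
    apply lim
    rw [haκ]
    exact ProudmanJohnson.tendsto_peak (div_neg_of_neg_of_pos (by norm_num) hl) hcont H.pos H.le
      H.finite
  · have hne : h a ≠ κ := fun e => hmem ((ProudmanJohnson.mem_maxPoints_iff hl a).2 ⟨ha, e⟩)
    obtain ⟨b, C, hC, hb, hq⟩ := H.exists_upper
    refine lim ((H.tendsto_num _ hne).div_atTop
      (ProudmanJohnson.tendsto_powMean_atTop ?_ hcont H.pos H.le hC hb hq))
    rw [neg_div, neg_le_neg_iff]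
    exact one_div_le_one_div_of_le hl hl2
  · have hl0 : 0 < lam := by linarith
    have hne : h a ≠ κ := fun e => hmem ((ProudmanJohnson.mem_maxPoints_iff hl0 a).2 ⟨ha, e⟩)
    have hm := ProudmanJohnson.tendsto_powMean_of_contact (p := 1 / lam) (by positivity)
      (one_div_lt_one_div_of_lt (by norm_num) hl) hcont H.periodic H.pos H.le H.finite
      (H.contact hl0 (hquad (by linarith)) hκ)
    rw [← neg_div] at hm
    exact limC hne hm.2 hm.1
  · have haκ : h a = κ := ((ProudmanJohnson.mem_minPoints_iff hl a).1 hmem).2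
    obtain ⟨hr, hpos, hlim⟩ := hnegLim hl
    have hr' : 0 < -1 / lam := div_pos_of_neg_of_neg (by norm_num) hl
    have hnum : Tendsto (fun μ => (1 - μ * h a) ^ (-1 / lam)) (𝓝[<] κ⁻¹) (𝓝 0) := by
      rw [haκ]
      have := ((ProudmanJohnson.tendsto_one_sub_mul H.pos).mono_right
        nhdsWithin_le_nhds).rpow_const (p := -1 / lam) (Or.inr hr)
      rwa [Real.zero_rpow hr'.ne'] at this
    have := lim (hnum.div hlim hpos.ne')
    rwa [zero_div] at this
  · have hne : h a ≠ κ := fun e => hmem ((ProudmanJohnson.mem_minPoints_iff hl a).2 ⟨ha, e⟩)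
    obtain ⟨-, hpos, hlim⟩ := hnegLim hl
    exact limC hne hpos hlim
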